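/- Relational structures are at most countable and have a finite relational signature. For structures $\mathbb A,\mathbb B$ in the same signature, $\mathrm{PCSP}(\mathbb A,\mathbb B)$ is the promise problem whose inputs are the finite structures $\mathbb X$ in that signature, where one accepts if $\mathbb X$ has a homomorphism to $\mathbb A$ and rejects if $\mathbb X$ has no homomorphism to $\mathbb B$; $\mathrm{CSP}(\mathbb A)=\mathrm{PCSP}(\mathbb A,\mathbb A)$. Such a problem is NP-hard if every language in NP has a polynomial-time many-one reduction to it. $\mathbb K_\ell$ denotes the complete graph on $\ell$ vertices. A permutation group $\mathscr G$ on a set $C$ is oligomorphic if for every $k$ it has finitely many orbits on $C^k$; its closure $\overline{\mathscr G}$ is the set of all $u\colon C\to C$ for which there is a sequence $(g_i)_{i\in\mathbb N}$ in $\mathscr G$ such that for every finite $F\subseteq C$ one has $g_i|_F=u|_F$ for all sufficiently large $i$. $\mathrm{Pol}(\mathbb C)$ is the set of all homomorphisms $\mathbb C^n\to\mathbb C$, $n\geq 1$. **Theorem.** Suppose that $\mathrm{PCSP}(\mathbb K_3,\mathbb K_\ell)$ is NP-hard for all $\ell\ge 3$. Let $\mathbb C$ be a structure with domain $C$ (at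 most countable, finite relational signature) and let $\mathscr G$ be an oligomorphic subgroup of $\mathrm{Aut}(\mathbb C)$. If $\mathrm{Pol}(\mathbb C)$ does not satisfy the 6-ary Siggers identity modulo $\overline{\mathscr G}$, that is, if there are no 6-ary $s\in\mathrm{Pol}(\mathbb C)$ and $u,v\in\overline{\mathscr G}$ such that $$u(s(x,y,x,z,y,z))=v(s(y,x,z,x,z,y))\qquad\text{for all }x,y,z\in C,$$ then $\mathrm{CSP}(\mathbb C)$ is NP-hard. -/

import Mathlib

open scoped FirstOrder

/-! ### Complexity: NP, promise problems and NP-hardness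

Polynomial-time computability is Mathlib's `Turing.TM2ComputableInPolyTime` (multi-stack Turing
machines). -/

/-- Encoding of a pair of binary words over the alphabet `{0, 1, #}` (here `# = none`). -/
def encodePair (p : List Bool × List Bool) : List (Option Bool) :=
  p.1.map some ++ none :: p.2.map some

/-- A language of binary words is in NP if it has a polynomial-time verifier for certificates of
polynomially bounded length. -/
def InNP (S : Set (List Bool)) : Prop :=
  ∃ (V : List Bool × List Bool → Bool) (p : Polynomial ℕ),
    Nonempty (Turing.TM2ComputableInPolyTime encodePair Computability.encodeBool V) ∧
    ∀ w, w ∈ S ↔ ∃ c : List Bool, c.length ≤ p.eval w.length ∧ V (w, c) = true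

/-- A promise problem on a type of instances: the instances to be accepted and the instances to be
rejected. Nothing is required on the other instances. -/
structure PromiseProblem (α : Type) where
  yes : α → Prop
  no : α → Prop

/-- A promise problem, whose instances are presented as words by `enc`, is NP-hard if every language
in NP has a polynomial-time many-one reduction to it. -/
def NPHard {α Γ : Type} (enc : α → List Γ) (P : PromiseProblem α) : Prop :=
  ∀ S : Set (List Bool), InNP S →
    ∃ f : List Bool → α,
      Nonempty (Turing.TM2ComputableInPolyTime (fun w : List Bool => w) enc f) ∧
      (∀ w ∈ S, P.yes (f w)) ∧ (∀ w ∉ S, P.no (f w))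

/-! ### Instances: finite structures given by an explicit list of their tuples -/

/-- A finite input structure in the relational signature `L`: its domain is `{0, …, size - 1}`,
and `tuples` lists the pairs `(R, x)` where the tuple `x` belongs to the relation `R`. -/
structure FinInstance (L : FirstOrder.Language.{0, 0}) where
  size : ℕ
  tuples : List (Σ R : (Σ n, L.Relations n), (Fin R.1 → Fin size))

/-- The domain of an input structure. -/
def FinInstance.Dom {L : FirstOrder.Language.{0, 0}} (X : FinInstance L) : Type := Fin X.size

/-- The structure presented by an instance. -/
instance FinInstance.instStructure {L : FirstOrder.Language.{0, 0}} [L.IsRelational]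
    (X : FinInstance L) : L.Structure X.Dom where
  funMap f := isEmptyElim f
  RelMap {n} R x := (⟨⟨n, R⟩, x⟩ : Σ R : (Σ n, L.Relations n), (Fin R.1 → Fin X.size)) ∈ X.tuples

/-- The letters used to write down instances: a tally mark, a separator, and the relation symbols. -/
inductive Letter (L : FirstOrder.Language.{0, 0}) : Type
  | tally
  | sep
  | sym (R : Σ n, L.Relations n)

/-- The number `k` in unary, followed by a separator. -/
def encodeUnary (L : FirstOrder.Language.{0, 0}) (k : ℕ) : List (Letter L) :=
  List.replicate k Letter.tally ++ [Letter.sep]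

/-- The word presenting an instance: the size of the domain, followed by all the tuples, each
preceded by its relation symbol. Elements are written in unary, which is polynomially equivalent to
writing them in binary since the size of the domain (the number of elements) is part of the size
of a structure. -/
def FinInstance.encode {L : FirstOrder.Language.{0, 0}} (X : FinInstance L) : List (Letter L) :=
  encodeUnary L X.size ++
    X.tuples.flatMap fun t =>
      Letter.sym t.1 :: (List.ofFn t.2).flatMap fun i => encodeUnary L i.val

/-! ### (Promise) constraint satisfaction problems -/

/-- `PCSP(A, B)`: accept the finite structures with a homomorphism to `A`, reject those without a
homomorphism to `B`. -/
def PCSP (L : FirstOrder.Language.{0, 0}) [L.IsRelational] (A B : Type*)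
    [L.Structure A] [L.Structure B] : PromiseProblem (FinInstance L) where
  yes X := Nonempty (X.Dom →[L] A)
  no X := ¬ Nonempty (X.Dom →[L] B)

/-- `CSP(A) = PCSP(A, A)`. -/
def CSP (L : FirstOrder.Language.{0, 0}) [L.IsRelational] (A : Type*) [L.Structure A] :
    PromiseProblem (FinInstance L) :=
  PCSP L A A

/-- The domain of the complete graph `K_r`. -/
def Clique (r : ℕ) : Type := Fin r

/-- `K_r` as a structure with one binary relation, which consists of all pairs of distinct
elements. -/
instance Clique.instStructure (r : ℕ) : FirstOrder.Language.graph.Structure (Clique r) :=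
  (⊤ : SimpleGraph (Fin r)).structure

/-! ### Polymorphisms -/

/-- The domain of the power `A^n`. -/
def Power (A : Type*) (n : ℕ) := Fin n → A

/-- The power `A^n` of a structure, with coordinatewise operations and relations. -/
instance Power.instStructure {L : FirstOrder.Language.{0, 0}} {A : Type*} [L.Structure A] (n : ℕ) :
    L.Structure (Power A n) where
  funMap f x := fun i => FirstOrder.Language.Structure.funMap f fun j => x j i
  RelMap R x := ∀ i, FirstOrder.Language.Structure.RelMap R fun j => x j i

/-- The `n`-ary polymorphisms of `A`. -/
abbrev Pol (L : FirstOrder.Language.{0, 0}) (A : Type*) [L.Structure A] (n : ℕ) :=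
  Power A n →[L] A

/-- The minor `f^σ` of an operation `f`: `(a_1, …, a_m) ↦ f (a_{σ(1)}, …, a_{σ(n)})`. -/
def minor {A : Type*} {n m : ℕ} (f : Power A n → A) (σ : Fin n → Fin m) : Power A m → A :=
  fun a => f fun i => a (σ i)

/-- `Pol(A)` satisfies the 6-ary Siggers identity `s(x,y,x,z,y,z) ≈ s(y,x,z,x,z,y)` modulo the
set `U` of unary operations: `u ∘ s(x,y,x,z,y,z) = v ∘ s(y,x,z,x,z,y)` for some `u, v ∈ U`. -/
def SatisfiesSiggersModulo (L : FirstOrder.Language.{0, 0}) (A : Type*) [L.Structure A]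
    (U : Set (A → A)) : Prop :=
  ∃ s : Pol L A 6, ∃ u ∈ U, ∃ v ∈ U,
    u ∘ minor (m := 3) s ![0, 1, 0, 2, 1, 2] = v ∘ minor (m := 3) s ![1, 0, 2, 0, 2, 1]

/-! ### Automorphisms and oligomorphic permutation groups -/

/-- The automorphism group of a structure, as a group of permutations of its domain. -/
def autGroup (L : FirstOrder.Language.{0, 0}) (A : Type*) [L.Structure A] :
    Subgroup (Equiv.Perm A) where
  carrier := {g | ∃ e : A ≃[L] A, e.toEquiv = g}
  mul_mem' := by
    rintro _ _ ⟨e, rfl⟩ ⟨e', rfl⟩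
    exact ⟨e.comp e', by ext; rfl⟩
  one_mem' := ⟨FirstOrder.Language.Equiv.refl L A, by ext; rfl⟩
  inv_mem' := by
    rintro _ ⟨e, rfl⟩
    exact ⟨e.symm, by ext; rfl⟩

/-- A permutation group is oligomorphic if it has finitely many orbits on `k`-tuples for all `k`. -/
def IsOligomorphic {A : Type*} (G : Subgroup (Equiv.Perm A)) : Prop :=
  ∀ k : ℕ, Finite (MulAction.orbitRel.Quotient G (Fin k → A))

/-- The closure of a permutation group in the space of all unary operations: the limits of the
pointwise convergent sequences of its elements, where every finite set of arguments is eventually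
mapped in the same way. -/
def unaryClosure {A : Type*} (G : Subgroup (Equiv.Perm A)) : Set (A → A) :=
  {u | ∃ g : ℕ → Equiv.Perm A, (∀ i, g i ∈ G) ∧
    ∀ F : Finset A, ∃ i₀, ∀ i ≥ i₀, ∀ x ∈ F, g i x = u x}

/-! ### Limits of sequences of functions modulo an oligomorphic group -/

theorem Ultrafilter.exists_eventually_eq {ι Q : Type*} [Finite Q] (U : Ultrafilter ι) (c : ι → Q) :
    ∃ q, ∀ᶠ i in (U : Filter ι), c i = q := by
  obtain ⟨q, hq⟩ := Ultrafilter.eq_pure_of_finite (U.map c)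
  refine ⟨q, ?_⟩
  have h : ({q} : Set Q) ∈ U.map c := by rw [hq]; exact Ultrafilter.mem_pure.2 rfl
  exact h

theorem IsOligomorphic.exists_limit_nat {C : Type*} {G : Subgroup (Equiv.Perm C)}
    (hG : IsOligomorphic G) (U : Ultrafilter ℕ) (f : ℕ → ℕ → C) :
    ∃ t : ℕ → C, ∀ k, ∀ᶠ n in (U : Filter ℕ), ∃ γ ∈ G, ∀ i < k, γ (f n i) = t i := by
  let P (k : ℕ) (t : ℕ → C) : Prop :=
    ∀ᶠ n in (U : Filter ℕ), ∃ γ ∈ G, ∀ i < k, γ (f n i) = t i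
  have step : ∀ k t, P k t → ∃ t', P (k + 1) t' ∧ ∀ i < k, t' i = t i := by
    intro k t ht
    have := hG (k + 1)
    obtain ⟨q, hq⟩ := U.exists_eventually_eq fun n =>
      (Quotient.mk (MulAction.orbitRel G (Fin (k + 1) → C)) fun i => f n i)
    -- One index n₀ lies in the generic orbit of (k+1)-tuples and is already moved onto t on the
    -- first k entries. Transporting its tuple by γ chooses the next value without changing the
    -- earlier ones.
    obtain ⟨n₀, hn₀, γ, hγ, hγt⟩ := (hq.and ht).exists
    refine ⟨fun i => γ (f n₀ i), ?_, fun i hi => hγt i hi⟩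
    filter_upwards [hq] with n hn
    obtain ⟨⟨δ, hδ⟩, hδe⟩ := Quotient.exact (hn₀.trans hn.symm)
    refine ⟨γ * δ, G.mul_mem hγ hδ, fun i hi => ?_⟩
    have := congrFun hδe ⟨i, hi⟩
    rw [Equiv.Perm.mul_apply]
    exact congrArg γ this
  choose nxt hnxt hext using step
  let T : ∀ k, {t // P k t} := fun k => Nat.rec (motive := fun k => {t // P k t})
    ⟨f 0, .of_forall fun n => ⟨1, G.one_mem, fun i hi => absurd hi i.not_lt_zero⟩⟩
    (fun k t => ⟨nxt k t.1 t.2, hnxt k t.1 t.2⟩) k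
  have hT : ∀ k i, i < k → (T k).1 i = (T (i + 1)).1 i := by
    intro k i hi
    induction k, hi using Nat.le_induction with
    | base => rfl
    | succ k hk ih => exact (hext k (T k).1 (T k).2 i hk).trans ih
  refine ⟨fun i => (T (i + 1)).1 i, fun k => ?_⟩
  filter_upwards [(T k).2] with n ⟨γ, hγ, h⟩
  exact ⟨γ, hγ, fun i hi => (h i hi).trans (hT k i hi)⟩

/-- A sequence of functions from a countable set has a limit along an ultrafilter, up to the action
of an oligomorphic group on the values. -/
theorem IsOligomorphic.exists_limit {C D : Type*} [Countable D] {G : Subgroup (Equiv.Perm C)}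
    (hG : IsOligomorphic G) (U : Ultrafilter ℕ) (f : ℕ → D → C) :
    ∃ t : D → C, ∀ S : Finset D, ∀ᶠ n in (U : Filter ℕ), ∃ γ ∈ G, ∀ x ∈ S, γ (f n x) = t x := by
  cases isEmpty_or_nonempty D with
  | inl h => exact ⟨f 0, fun S => .of_forall fun n => ⟨1, G.one_mem, fun x => isEmptyElim x⟩⟩
  | inr h =>
    obtain ⟨e, he⟩ := exists_surjective_nat D
    obtain ⟨t, ht⟩ := hG.exists_limit_nat U fun n i => f n (e i)
    refine ⟨fun d => t (Function.surjInv he d), fun S => ?_⟩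
    filter_upwards [ht (S.sup (Function.surjInv he) + 1)] with n ⟨γ, hγ, h⟩
    refine ⟨γ, hγ, fun x hx => ?_⟩
    rw [← h _ (Nat.lt_succ_of_le (Finset.le_sup (f := Function.surjInv he) hx)),
      Function.surjInv_eq he]

theorem exists_seq_finset_exhausting (D : Type*) [Countable D] :
    ∃ V : ℕ → Finset D, ∀ d, ∃ N, ∀ n ≥ N, d ∈ V n := by
  classical
  obtain ⟨e, he⟩ := exists_injective_nat D
  have hfin : ∀ n, {d | e d < n}.Finite := fun n =>
    (Set.finite_lt_nat n).preimage he.injOn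
  refine ⟨fun n => (hfin n).toFinset, fun d => ⟨e d + 1, fun n hn => ?_⟩⟩
  simpa using hn

/-! ### A finite obstruction to the Siggers identity -/

/-- A map that preserves all relations between the elements of the set `V`. -/
def IsHomOn (L : FirstOrder.Language.{0, 0}) {A B : Type*} [L.Structure A] [L.Structure B]
    (V : Set A) (s : A → B) : Prop :=
  ∀ ⦃n : ℕ⦄ (R : L.Relations n) (x : Fin n → A), (∀ i, x i ∈ V) →
    FirstOrder.Language.Structure.RelMap R x →
    FirstOrder.Language.Structure.RelMap R fun i => s (x i)

theorem relMap_of_mem_autGroup {L : FirstOrder.Language.{0, 0}} {A : Type*} [L.Structure A]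
    {γ : Equiv.Perm A} (hγ : γ ∈ autGroup L A) {n : ℕ} (R : L.Relations n) (x : Fin n → A) :
    FirstOrder.Language.Structure.RelMap R (fun i => γ (x i)) ↔
      FirstOrder.Language.Structure.RelMap R x := by
  obtain ⟨e, rfl⟩ := hγ
  exact e.map_rel R x

theorem eventually_hyperfilter_ge (N : ℕ) : ∀ᶠ n in (Filter.hyperfilter ℕ : Filter ℕ), N ≤ n :=
  Filter.hyperfilter_le_cofinite (Nat.cofinite_eq_atTop ▸ Filter.eventually_ge_atTop N)

/-- The left-hand side `(x, y, x, z, y, z)` of the Siggers identity. -/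
def siggersLeft {A : Type*} (a : Fin 3 → A) : Power A 6 := fun i => a (![0, 1, 0, 2, 1, 2] i)

/-- The right-hand side `(y, x, z, x, z, y)` of the Siggers identity. -/
def siggersRight {A : Type*} (a : Fin 3 → A) : Power A 6 := fun i => a (![1, 0, 2, 0, 2, 1] i)

/-- A sequence of partial solutions to the Siggers identity yields a solution modulo the closure
of the group. -/
theorem satisfiesSiggersModulo_of_finite (L : FirstOrder.Language.{0, 0}) [L.IsRelational]
    {C : Type*} [Countable C] [L.Structure C] {G : Subgroup (Equiv.Perm C)}
    (hG : G ≤ autGroup L C) (hGo : IsOligomorphic G)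
    (h : ∀ (V : Finset (Power C 6)) (F : Finset C), ∃ s : Power C 6 → C, IsHomOn L V s ∧
      ∃ γ ∈ G, ∀ a : Fin 3 → C, (∀ i, a i ∈ F) → γ (s (siggersLeft a)) = s (siggersRight a)) :
    SatisfiesSiggersModulo L C (unaryClosure G) := by
  classical
  have hc : Countable (Power C 6) := inferInstanceAs (Countable (Fin 6 → C))
  obtain ⟨V, hV⟩ := exists_seq_finset_exhausting (Power C 6)
  obtain ⟨F, hF⟩ := exists_seq_finset_exhausting C
  choose S hS Γ hΓ hSΓ using fun n => h (V n) (F n)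
  obtain ⟨s, hs⟩ := hGo.exists_limit (Filter.hyperfilter ℕ) S
  have ev : ∀ {D : Type _} {V : ℕ → Finset D} (_ : ∀ d, ∃ N, ∀ n ≥ N, d ∈ V n) (d : D),
      ∀ᶠ n in (Filter.hyperfilter ℕ : Filter ℕ), d ∈ V n := by
    intro D V hV d
    obtain ⟨N, hN⟩ := hV d
    filter_upwards [eventually_hyperfilter_ge N] with n hn using hN n hn
  let s' : Pol L C 6 :=
    { toFun := s
      map_fun' := fun f => isEmptyElim f
      map_rel' := by
        intro n R x hx
        have h1 : ∀ᶠ k in (Filter.hyperfilter ℕ : Filter ℕ), ∀ i, x i ∈ V k :=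
          Filter.eventually_all.2 fun i => ev hV (x i)
        obtain ⟨k, hk, γ, hγ, hγs⟩ := (h1.and (hs (Finset.univ.image x))).exists
        have h2 := (relMap_of_mem_autGroup (hG hγ) R _).2 (hS k R x hk hx)
        have h3 : (fun i => γ (S k (x i))) = s ∘ x :=
          funext fun i => hγs (x i) (Finset.mem_image_of_mem x (Finset.mem_univ i))
        rwa [h3] at h2 }
  have hloc : ∀ F' : Finset C, ∃ δ ∈ G, ∀ a : Fin 3 → C, (∀ i, a i ∈ F') →
      δ (s (siggersLeft a)) = s (siggersRight a) := by
    intro F'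
    let T := Fintype.piFinset fun _ : Fin 3 => F'
    have h1 : ∀ᶠ k in (Filter.hyperfilter ℕ : Filter ℕ), ∀ x ∈ F', x ∈ F k :=
      (Filter.eventually_all_finset F').2 fun x _ => ev hF x
    obtain ⟨k, hk, γ, hγ, hγs⟩ :=
      (h1.and (hs (T.image siggersLeft ∪ T.image siggersRight))).exists
    -- Passing from `S k` to the limit multiplies values by γ, so the witness `Γ k` has to be
    -- conjugated by γ.
    refine ⟨γ * Γ k * γ⁻¹, G.mul_mem (G.mul_mem hγ (hΓ k)) (G.inv_mem hγ), fun a ha => ?_⟩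
    have haT : a ∈ T := Fintype.mem_piFinset.2 ha
    rw [← hγs _ (Finset.mem_union_left _ (Finset.mem_image_of_mem _ haT)),
      ← hγs _ (Finset.mem_union_right _ (Finset.mem_image_of_mem _ haT)),
      ← hSΓ k a fun i => hk _ (ha i)]
    simp
  choose δ hδ hδs using fun n => hloc (F n)
  -- The δ n need not converge, but the pairs (δ n, id) have a joint limit (u, v) modulo G. Using
  -- the same γ on both summands is what turns δ(s(left a)) = s(right a) into u(s(left a)) =
  -- v(s(right a)).
  obtain ⟨t, ht⟩ := hGo.exists_limit (Filter.hyperfilter ℕ)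
    (fun n => Sum.elim (fun x : C => δ n x) fun x : C => x)
  have hsub : ∀ n, ∃ k, n ≤ k ∧ ∃ γ ∈ G, (∀ x ∈ F n, γ (δ k x) = t (Sum.inl x)) ∧
      ∀ x ∈ F n, γ x = t (Sum.inr x) := by
    intro n
    obtain ⟨k, hk, γ, hγ, hγt⟩ :=
      ((eventually_hyperfilter_ge n).and (ht ((F n).disjSum (F n)))).exists
    exact ⟨k, hk, γ, hγ, fun x hx => hγt _ (Finset.inl_mem_disjSum.2 hx),
      fun x hx => hγt _ (Finset.inr_mem_disjSum.2 hx)⟩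
  choose φ hφ γ hγ hγl hγr using hsub
  have evF : ∀ F' : Finset C, ∃ N, ∀ n ≥ N, ∀ x ∈ F', x ∈ F n := by
    intro F'
    choose N hN using hF
    exact ⟨F'.sup N, fun n hn x hx => hN x n ((Finset.le_sup hx).trans hn)⟩
  refine ⟨s', fun x => t (Sum.inl x), ⟨fun n => γ n * δ (φ n), fun n =>
    G.mul_mem (hγ n) (hδ _), fun F' => ?_⟩, fun x => t (Sum.inr x), ⟨γ, hγ, fun F' => ?_⟩, ?_⟩
  · obtain ⟨N, hN⟩ := evF F'
    exact ⟨N, fun n hn x hx => hγl n x (hN n hn x hx)⟩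
  · obtain ⟨N, hN⟩ := evF F'
    exact ⟨N, fun n hn x hx => hγr n x (hN n hn x hx)⟩
  · funext a
    change t (Sum.inl (s (siggersLeft a))) = t (Sum.inr (s (siggersRight a)))
    obtain ⟨N, hN⟩ := evF (Finset.univ.image a ∪ {s (siggersLeft a), s (siggersRight a)})
    have h1 : ∀ i, a i ∈ F (φ N) := fun i => hN (φ N) (hφ N) _
      (Finset.mem_union_left _ (Finset.mem_image_of_mem a (Finset.mem_univ i)))
    rw [← hγl N _ (hN N le_rfl _ (by simp)), ← hγr N _ (hN N le_rfl _ (by simp)),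
      hδs (φ N) a h1]

/-! ### Gadget replacement -/

theorem graphRelation_arity (R : Σ n, FirstOrder.Language.graph.Relations n) : R.1 = 2 := by
  obtain ⟨_, ⟨⟩⟩ := R
  rfl

/-- The two ends of an edge. -/
def edgeEnd {A : Type*} (x : Σ R : (Σ n, FirstOrder.Language.graph.Relations n), (Fin R.1 → A))
    (i : Fin 2) : A :=
  x.2 (Fin.cast (graphRelation_arity x.1).symm i)

/-- A gadget that replaces the edges of a graph. The elements of the gadget are pairs: the second
component is a slot, and the first component says whether the element belongs to the first end of
the edge, to the second end of the edge, to the edge itself, or to the whole graph. -/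
structure Gadget (L : FirstOrder.Language.{0, 0}) where
  slots : ℕ
  tuples : List (Σ R : (Σ n, L.Relations n), (Fin R.1 → Fin 4 × Fin slots))

/-- The objects to which the elements of a copy of a gadget belong: the ends of the edge, the number
of the edge, and `0` for the elements shared by all copies. -/
def edgeCounters {m : ℕ}
    (x : Σ R : (Σ n, FirstOrder.Language.graph.Relations n), (Fin R.1 → Fin m)) (t : ℕ) :
    Fin 4 → ℕ :=
  ![(edgeEnd x 0).val, (edgeEnd x 1).val, t, 0]

theorem edgeCounters_lt {m l : ℕ}
    (x : Σ R : (Σ n, FirstOrder.Language.graph.Relations n), (Fin R.1 → Fin m)) {t : ℕ}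
    (ht : t < m + l) (w : Fin 4) : edgeCounters x t w < m + l := by
  have h0 := (edgeEnd x 0).isLt
  have h1 := (edgeEnd x 1).isLt
  fin_cases w <;> simp [edgeCounters] <;> omega

theorem mul_add_lt_mul {a b k c : ℕ} (h : a < b) (hc : c < k) : a * k + c < b * k :=
  calc a * k + c < (a + 1) * k := by rw [Nat.succ_mul]; omega
    _ ≤ b * k := Nat.mul_le_mul_right k h

theorem lt_of_mem_zipIdx {α : Type*} {l : List α} {n : ℕ} {e : α × ℕ} (h : e ∈ l.zipIdx n) :
    e.2 < n + l.length :=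
  (List.mem_zipIdx h).2.1

/-- Replaces every edge of a graph by a copy of the gadget. -/
def Gadget.replace {L : FirstOrder.Language.{0, 0}} (g : Gadget L)
    (X : FinInstance FirstOrder.Language.graph) : FinInstance L where
  size := (X.size + X.tuples.length) * g.slots
  -- Edges are numbered after the vertices, so a number determines its vertex or edge. The reversal
  -- matches a machine that pushes the output for each edge onto a stack as the edge is read.
  tuples := (X.tuples.zipIdx X.size).attach.reverse.flatMap fun e => g.tuples.map fun r =>
    ⟨r.1, fun i => ⟨edgeCounters e.1.1 e.1.2 (r.2 i).1 * g.slots + (r.2 i).2,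
      mul_add_lt_mul (edgeCounters_lt e.1.1 (lt_of_mem_zipIdx e.2) _) (r.2 i).2.isLt⟩⟩

theorem Gadget.mem_replace_tuples {L : FirstOrder.Language.{0, 0}} (g : Gadget L)
    (X : FinInstance FirstOrder.Language.graph)
    (y : Σ R : (Σ n, L.Relations n), (Fin R.1 → Fin (g.replace X).size)) :
    y ∈ (g.replace X).tuples ↔ ∃ (e : _ × ℕ) (he : e ∈ X.tuples.zipIdx X.size),
      ∃ r ∈ g.tuples, (⟨r.1, fun i => ⟨edgeCounters e.1 e.2 (r.2 i).1 * g.slots + (r.2 i).2,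
        mul_add_lt_mul (edgeCounters_lt e.1 (lt_of_mem_zipIdx he) _) (r.2 i).2.isLt⟩⟩ :
          Σ R : (Σ n, L.Relations n), (Fin R.1 → Fin (g.replace X).size)) = y := by
  refine List.mem_flatMap.trans ⟨?_, ?_⟩
  · rintro ⟨⟨e, he⟩, -, h⟩
    obtain ⟨r, hr, h⟩ := List.mem_map.1 h
    exact ⟨e, he, r, hr, h⟩
  · rintro ⟨e, he, r, hr, h⟩
    exact ⟨⟨e, he⟩, List.mem_reverse.2 (List.mem_attach _ _), List.mem_map.2 ⟨r, hr, h⟩⟩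

/-! ### The gadget of the Siggers identity -/

section SiggersGadget

variable {C : Type*}

theorem siggersRight_injective : Function.Injective (siggersRight (A := C)) := by
  intro a b h
  have h0 := congrFun h 1
  have h1 := congrFun h 0
  have h3 := congrFun h 2
  funext i
  fin_cases i
  · exact h0
  · exact h1
  · exact h3

/-- A constant tuple. -/
def IsConstTuple (v : Power C 6) : Prop := ∀ i, v i = v 0

theorem siggersRight_eq_of_isConstTuple {a : Fin 3 → C} (h : IsConstTuple (siggersRight a)) :
    siggersRight a = siggersLeft a := by
  have h1 : a 0 = a 1 := h 1
  have h2 : a 2 = a 1 := h 2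
  funext i
  fin_cases i <;> simp [siggersLeft, siggersRight, h1, h2]

/-- Only constant tuples could be claimed by both ends of an edge. Sharing these among all copies
therefore makes the gluing unambiguous. -/
theorem isConstTuple_of_siggersLeft_eq_siggersRight {a b : Fin 3 → C}
    (h : siggersLeft a = siggersRight b) : IsConstTuple (siggersLeft a) := by
  have h0 : a 0 = b 1 := congrFun h 0
  have h1 : a 1 = b 0 := congrFun h 1
  have h2 : a 0 = b 2 := congrFun h 2
  have h3 : a 2 = b 0 := congrFun h 3
  have h4 : a 1 = b 2 := congrFun h 4
  have h10 : a 1 = a 0 := h4.trans h2.symm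
  have h20 : a 2 = a 0 := h3.trans (h1.symm.trans h10)
  intro i
  fin_cases i <;> simp [siggersLeft, h10, h20]

variable (V : Finset (Power C 6)) (F : Finset C)
  (hp : ∀ a : Fin 3 → C, (∀ i, a i ∈ F) → siggersLeft a ∈ V)

open scoped Classical in
/-- The element of the gadget that represents an element of `V`. -/
noncomputable def siggersAddress (v : V) : Fin 4 × V :=
  if IsConstTuple v.1 then (3, v)
  else if ∃ a : Fin 3 → C, (∀ i, a i ∈ F) ∧ v.1 = siggersLeft a then (0, v)
  else if h : ∃ a : Fin 3 → C, (∀ i, a i ∈ F) ∧ v.1 = siggersRight a then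
    (1, ⟨siggersLeft h.choose, hp _ h.choose_spec.1⟩)
  else (2, v)

theorem siggersAddress_siggersLeft (a : Fin 3 → C) (ha : ∀ i, a i ∈ F)
    (hc : ¬ IsConstTuple (siggersLeft a)) :
    siggersAddress V F hp ⟨siggersLeft a, hp a ha⟩ = (0, ⟨siggersLeft a, hp a ha⟩) := by
  rw [siggersAddress, if_neg hc, if_pos ⟨a, ha, rfl⟩]

theorem siggersAddress_siggersRight (a : Fin 3 → C) (ha : ∀ i, a i ∈ F)
    (hv : siggersRight a ∈ V) (hc : ¬ IsConstTuple (siggersRight a)) :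
    siggersAddress V F hp ⟨siggersRight a, hv⟩ = (1, ⟨siggersLeft a, hp a ha⟩) := by
  have h1 : ¬ ∃ b : Fin 3 → C, (∀ i, b i ∈ F) ∧ siggersRight a = siggersLeft b := by
    rintro ⟨b, -, h⟩
    exact hc (h ▸ isConstTuple_of_siggersLeft_eq_siggersRight h.symm)
  have h2 : ∃ b : Fin 3 → C, (∀ i, b i ∈ F) ∧ siggersRight a = siggersRight b := ⟨a, ha, rfl⟩
  rw [siggersAddress, if_neg hc, if_neg h1, dif_pos h2]
  have h3 : h2.choose = a := siggersRight_injective h2.choose_spec.2.symm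
  congr 3

theorem siggersAddress_of_isConstTuple (v : V) (hc : IsConstTuple v.1) :
    siggersAddress V F hp v = (3, v) := by
  rw [siggersAddress, if_pos hc]

/-- The coordinate at which the two sides of the Siggers identity are the variables `c` and `d`. -/
def siggersCoord (c d : Fin 3) : Fin 6 := ![![0, 0, 2], ![1, 0, 4], ![3, 5, 0] ] c d

theorem siggersLeft_siggersCoord (a : Fin 3 → C) {c d : Fin 3} (h : c ≠ d) :
    siggersLeft a (siggersCoord c d) = a c := by
  fin_cases c <;> fin_cases d <;> first | exact absurd rfl h | rfl

theorem siggersRight_siggersCoord (a : Fin 3 → C) {c d : Fin 3} (h : c ≠ d) :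
    siggersRight a (siggersCoord c d) = a d := by
  fin_cases c <;> fin_cases d <;> first | exact absurd rfl h | rfl

/-- A vertex knows its own colour but not that of a neighbour. It can use the first occurrence of
its colour on the left-hand side, since only that variable of a matters. -/
theorem siggersLeft_coord (a : Fin 3 → C) (c : Fin 3) :
    siggersLeft a (![0, 1, 3] c) = a c := by
  fin_cases c <;> rfl

/-- The value of an element of the gadget, for an edge whose ends have the colours `c` and `d`, is
the corresponding coordinate of the element of `V` that it represents. -/
theorem siggersAddress_value (v : V) {c d : Fin 3} (h : c ≠ d) (b : Fin 6) :
    (siggersAddress V F hp v).2.1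
      (![![0, 1, 3] c, ![0, 1, 3] d, siggersCoord c d, b] (siggersAddress V F hp v).1) =
        v.1 (siggersCoord c d) := by
  by_cases hc : IsConstTuple v.1
  · rw [siggersAddress_of_isConstTuple V F hp v hc, hc, hc (siggersCoord c d)]
  by_cases h1 : ∃ a : Fin 3 → C, (∀ i, a i ∈ F) ∧ v.1 = siggersLeft a
  · obtain ⟨a, ha, hva⟩ := h1
    obtain ⟨v, hv⟩ := v
    subst hva
    rw [siggersAddress_siggersLeft V F hp a ha hc]
    exact (siggersLeft_coord a c).trans (siggersLeft_siggersCoord a h).symm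
  by_cases h2 : ∃ a : Fin 3 → C, (∀ i, a i ∈ F) ∧ v.1 = siggersRight a
  · obtain ⟨a, ha, hva⟩ := h2
    obtain ⟨v, hv⟩ := v
    subst hva
    rw [siggersAddress_siggersRight V F hp a ha hv hc]
    exact (siggersLeft_coord a d).trans (siggersRight_siggersCoord a h).symm
  · rw [siggersAddress, if_neg hc, if_neg h1, dif_neg h2]
    rfl

variable (L : FirstOrder.Language.{0, 0}) [Finite (Σ n, L.Relations n)] [L.Structure C]

/-- The structure induced by `C ^ 6` on `V`, as a gadget. -/
noncomputable def siggersGadget : Gadget L where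
  slots := V.card
  tuples :=
    (Set.toFinite {y : Σ R : (Σ n, L.Relations n), (Fin R.1 → V) |
      FirstOrder.Language.Structure.RelMap y.1.2 fun i => (y.2 i).1}).toFinset.toList.map
      fun y => ⟨y.1, fun i => ((siggersAddress V F hp (y.2 i)).1,
        V.equivFin (siggersAddress V F hp (y.2 i)).2)⟩

theorem mem_siggersGadget_tuples
    (r : Σ R : (Σ n, L.Relations n), (Fin R.1 → Fin 4 × Fin V.card)) :
    r ∈ (siggersGadget V F hp L).tuples ↔ ∃ y : Σ R : (Σ n, L.Relations n), (Fin R.1 → V),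
      (FirstOrder.Language.Structure.RelMap y.1.2 fun i => (y.2 i).1) ∧
      (⟨y.1, fun i => ((siggersAddress V F hp (y.2 i)).1,
        V.equivFin (siggersAddress V F hp (y.2 i)).2)⟩ :
          Σ R : (Σ n, L.Relations n), (Fin R.1 → Fin 4 × Fin V.card)) = r := by
  refine List.mem_map.trans (exists_congr fun y => and_congr_left fun _ => ?_)
  rw [Finset.mem_toList, Set.Finite.mem_toFinset]
  rfl

/-- A graph with a homomorphism to `K_3` is mapped to a structure with a homomorphism to `C`. -/
theorem nonempty_hom_replace_siggersGadget [L.IsRelational]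
    (X : FinInstance FirstOrder.Language.graph)
    (hX : Nonempty (X.Dom →[FirstOrder.Language.graph] Clique 3)) :
    Nonempty (((siggersGadget V F hp L).replace X).Dom →[L] C) := by
  obtain ⟨f⟩ := hX
  let col : Fin X.size → Fin 3 := f
  have hcol : ∀ x ∈ X.tuples, col (edgeEnd x 0) ≠ col (edgeEnd x 1) := by
    rintro ⟨⟨_, ⟨⟩⟩, x⟩ hx
    exact f.map_rel FirstOrder.Language.adj x hx
  have hpos : ∀ y : Fin ((X.size + X.tuples.length) * V.card), 0 < V.card := fun y =>
    Nat.pos_of_mul_pos_left (Nat.zero_lt_of_lt y.isLt)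
  -- The coordinate to which the elements of object t are projected: for a vertex it depends on its
  -- colour, for an edge on the colours of both ends.
  let coord : ℕ → Fin 6 := fun t =>
    if h : t < X.size then ![0, 1, 3] (col ⟨t, h⟩)
    else if h : t - X.size < X.tuples.length then
      siggersCoord (col (edgeEnd X.tuples[t - X.size] 0)) (col (edgeEnd X.tuples[t - X.size] 1))
    else 0
  let val : Fin ((X.size + X.tuples.length) * V.card) → C := fun y =>
    (V.equivFin.symm ⟨y.1 % V.card, Nat.mod_lt _ (hpos y)⟩).1 (coord (y.1 / V.card))
  have hval : ∀ (t : ℕ) (v : V) (h : t * V.card + (V.equivFin v).1 <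
      (X.size + X.tuples.length) * V.card), val ⟨_, h⟩ = v.1 (coord t) := by
    intro t v h
    have hv := (V.equivFin v).isLt
    have h1 : (t * V.card + (V.equivFin v).1) / V.card = t := by
      rw [Nat.add_comm, Nat.add_mul_div_right _ _ (hpos ⟨_, h⟩), Nat.div_eq_of_lt hv, zero_add]
    have h2 : (t * V.card + (V.equivFin v).1) % V.card = (V.equivFin v).1 := by
      rw [Nat.add_comm, Nat.add_mul_mod_self_right, Nat.mod_eq_of_lt hv]
    simp only [val, h1, h2, Fin.eta, Equiv.symm_apply_apply]
  have hrel : ∀ y ∈ ((siggersGadget V F hp L).replace X).tuples,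
      FirstOrder.Language.Structure.RelMap y.1.2 fun i => val (y.2 i) := by
    intro y hy
    obtain ⟨⟨x, t⟩, he, r, hr, rfl⟩ := (Gadget.mem_replace_tuples _ X _).1 hy
    obtain ⟨z, hz, rfl⟩ := (mem_siggersGadget_tuples V F hp L r).1 hr
    obtain ⟨hle, hlt, hxt⟩ := List.mem_zipIdx he
    have hx : x ∈ X.tuples := hxt ▸ List.getElem_mem _
    have hcoord : ∀ w, ∃ b, coord (edgeCounters x t w) =
        ![![0, 1, 3] (col (edgeEnd x 0)), ![0, 1, 3] (col (edgeEnd x 1)),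
          siggersCoord (col (edgeEnd x 0)) (col (edgeEnd x 1)), b] w := by
      intro w
      fin_cases w
      · exact ⟨0, dif_pos (edgeEnd x 0).isLt⟩
      · exact ⟨0, dif_pos (edgeEnd x 1).isLt⟩
      · refine ⟨0, (dif_neg hle.not_gt).trans ?_⟩
        have h1 : t - X.size < X.tuples.length := by
          have hlt' : t < X.size + X.tuples.length := hlt
          omega
        refine (dif_pos h1).trans ?_
        rw [hxt]
        rfl
      -- Shared elements carry the number 0 of a vertex, but they are constant tuples, for which the
      -- choice of coordinate is irrelevant.
      · exact ⟨coord 0, rfl⟩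
    have h1 := hz (siggersCoord (col (edgeEnd x 0)) (col (edgeEnd x 1)))
    convert h1 using 2 with i
    refine (hval _ _ _).trans ?_
    obtain ⟨b, hb⟩ := hcoord (siggersAddress V F hp (z.2 i)).1
    rw [hb]
    exact siggersAddress_value V F hp (z.2 i) (hcol x hx) b
  exact ⟨{ toFun := val
           map_fun' := fun f => isEmptyElim f
           map_rel' := fun R y hy => hrel ⟨⟨_, R⟩, y⟩ hy }⟩

/-- If the gadget has no homomorphism to `C` that maps both ends to the same orbit, then a structure
obtained by gadget replacement and with a homomorphism to `C` comes from a graph that can be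
coloured by the orbits. -/
theorem exists_hom_clique_of_hom_replace_siggersGadget [L.IsRelational]
    (hq : ∀ a : Fin 3 → C, (∀ i, a i ∈ F) → siggersRight a ∈ V)
    {G : Subgroup (Equiv.Perm C)} (hGo : IsOligomorphic G)
    (hV : ∀ s : Power C 6 → C, IsHomOn L V s → ∀ γ ∈ G,
      ¬ ∀ a : Fin 3 → C, (∀ i, a i ∈ F) → γ (s (siggersLeft a)) = s (siggersRight a)) :
    ∃ r ≥ 3, ∀ X : FinInstance FirstOrder.Language.graph,
      Nonempty (((siggersGadget V F hp L).replace X).Dom →[L] C) →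
      Nonempty (X.Dom →[FirstOrder.Language.graph] Clique r) := by
  classical
  let e := Fintype.equivFin (Fin 3 → F)
  let k := Fintype.card (Fin 3 → F)
  let Q := MulAction.orbitRel.Quotient G (Fin k → C)
  have hQ : Finite Q := hGo k
  -- The colours are the orbits; the maximum with 3 only secures the lower bound on r.
  let c : Q → Fin (max 3 (Nat.card Q)) := fun q =>
    Fin.castLE (le_max_right _ _) (Finite.equivFin Q q)
  have hc : Function.Injective c :=
    (Fin.castLE_injective _).comp (Finite.equivFin Q).injective
  refine ⟨max 3 (Nat.card Q), le_max_left _ _, ?_⟩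
  rintro X ⟨f⟩
  let val : ℕ → V → C := fun t v =>
    if h : t < X.size + X.tuples.length then
      f (⟨t * V.card + (V.equivFin v).1, mul_add_lt_mul h (V.equivFin v).isLt⟩ :
        Fin ((X.size + X.tuples.length) * V.card))
    else v.1 0
  let left : (Fin 3 → F) → V := fun a => ⟨siggersLeft fun i => a i, hp _ fun i => (a i).2⟩
  -- The values at vertex t of all tuples left a, a ∈ F^3; constant tuples are looked up under the
  -- shared number 0.
  let tup : ℕ → (Fin k → C) := fun t j =>
    val (if IsConstTuple (left (e.symm j)).1 then 0 else t) (left (e.symm j))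
  let col : Fin X.size → Fin (max 3 (Nat.card Q)) := fun t => c (Quotient.mk _ (tup t))
  have hcol : ∀ x ∈ X.tuples, col (edgeEnd x 0) ≠ col (edgeEnd x 1) := by
    intro x hx heq
    obtain ⟨t, he⟩ : ∃ t, (x, t) ∈ X.tuples.zipIdx X.size := by
      obtain ⟨j, hj, rfl⟩ := List.getElem_of_mem hx
      exact ⟨X.size + j, List.mk_add_mem_zipIdx_iff_getElem?.2 (List.getElem?_eq_getElem hj)⟩
    obtain ⟨⟨γ, hγ⟩, hγe⟩ := Quotient.exact (hc heq)
    -- The restriction of the homomorphism to the copy of V at the offending edge; the values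
    -- outside V play no role.
    let s : Power C 6 → C := fun v => if h : v ∈ V then
      val (edgeCounters x t (siggersAddress V F hp ⟨v, h⟩).1) (siggersAddress V F hp ⟨v, h⟩).2
      else v 0
    have hs : ∀ v : V, s v.1 =
        val (edgeCounters x t (siggersAddress V F hp v).1) (siggersAddress V F hp v).2 :=
      fun v => dif_pos v.2
    have hhom : IsHomOn L V s := by
      intro n R y hy hR
      have h1 := (mem_siggersGadget_tuples V F hp L _).2
        ⟨⟨⟨n, R⟩, fun i => (⟨y i, hy i⟩ : V)⟩, hR, rfl⟩
      have h2 := (Gadget.mem_replace_tuples _ X _).2 ⟨(x, t), he, _, h1, rfl⟩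
      have h3 := f.map_rel R _ h2
      convert h3 using 2 with i
      refine (hs ⟨y i, hy i⟩).trans ?_
      exact dif_pos (edgeCounters_lt x (lt_of_mem_zipIdx he) _)
    have hleft : ∀ a : Fin 3 → F, s (siggersLeft fun i => a i) = tup (edgeEnd x 0).val (e a) := by
      intro a
      refine (hs (left a)).trans ?_
      simp only [tup, Equiv.symm_apply_apply]
      by_cases h : IsConstTuple (left a).1
      · rw [siggersAddress_of_isConstTuple V F hp _ h, if_pos h]
        rfl
      · rw [siggersAddress_siggersLeft V F hp _ (fun i => (a i).2) h, if_neg h]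
        rfl
    have hright : ∀ a : Fin 3 → F, s (siggersRight fun i => a i) = tup (edgeEnd x 1).val (e a) := by
      intro a
      -- If right a is constant, it equals left a and is a shared element, so both vertices record
      -- the same value for it.
      by_cases h : IsConstTuple (siggersRight fun i => (a i).1)
      · have h1 := siggersRight_eq_of_isConstTuple h
        rw [h1, hleft]
        rw [h1] at h
        simp only [tup, Equiv.symm_apply_apply]
        rw [if_pos h, if_pos h]
      · have h1 : ¬ IsConstTuple (left a).1 := by
          intro h2
          have h3 : a 1 = a 0 := Subtype.ext (h2 1)
          have h4 : a 2 = a 0 := Subtype.ext (h2 3)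
          refine h fun i => ?_
          fin_cases i <;> simp [siggersRight, h3, h4]
        refine (hs ⟨_, hq _ fun i => (a i).2⟩).trans ?_
        rw [siggersAddress_siggersRight V F hp _ (fun i => (a i).2) _ h]
        simp only [tup, Equiv.symm_apply_apply]
        rw [if_neg h1]
        rfl
    refine hV s hhom γ⁻¹ (G.inv_mem hγ) fun a ha => ?_
    have h0 := hleft fun i => ⟨a i, ha i⟩
    have h1 := hright fun i => ⟨a i, ha i⟩
    have h2 := congrFun hγe (e fun i => ⟨a i, ha i⟩)
    rw [h0, h1, ← h2]
    exact γ.symm_apply_apply _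
  refine ⟨{ toFun := col, map_fun' := fun f => isEmptyElim f, map_rel' := ?_ }⟩
  rintro _ ⟨⟩ x hx
  exact hcol ⟨⟨2, FirstOrder.Language.adj⟩, x⟩ hx

end SiggersGadget

/-- If the Siggers identity fails modulo the closure of an oligomorphic group, then a gadget
reduces the colouring of graphs, with the promise of a `3`-colouring, to `CSP(C)`. -/
theorem exists_gadget_of_not_satisfiesSiggersModulo (L : FirstOrder.Language.{0, 0})
    [L.IsRelational] [Finite (Σ n, L.Relations n)] (C : Type*) [Countable C] [L.Structure C]
    (G : Subgroup (Equiv.Perm C)) (hG : G ≤ autGroup L C) (hGo : IsOligomorphic G)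
    (hS : ¬ SatisfiesSiggersModulo L C (unaryClosure G)) :
    ∃ g : Gadget L, ∃ r ≥ 3, ∀ X : FinInstance FirstOrder.Language.graph,
      (Nonempty (X.Dom →[FirstOrder.Language.graph] Clique 3) →
        Nonempty ((g.replace X).Dom →[L] C)) ∧
      (Nonempty ((g.replace X).Dom →[L] C) →
        Nonempty (X.Dom →[FirstOrder.Language.graph] Clique r)) := by
  classical
  have h := mt (satisfiesSiggersModulo_of_finite L hG hGo) hS
  push Not at h
  obtain ⟨V₀, F, hV₀⟩ := h
  let T := Fintype.piFinset fun _ : Fin 3 => F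
  -- Enlarging V only strengthens the demand on s, so the obstruction survives when both sides of
  -- the identity over F are included.
  let V := V₀ ∪ (T.image siggersLeft ∪ T.image siggersRight)
  have hp : ∀ a : Fin 3 → C, (∀ i, a i ∈ F) → siggersLeft a ∈ V := fun a ha =>
    Finset.mem_union_right _ (Finset.mem_union_left _
      (Finset.mem_image_of_mem _ (Fintype.mem_piFinset.2 ha)))
  have hq : ∀ a : Fin 3 → C, (∀ i, a i ∈ F) → siggersRight a ∈ V := fun a ha =>
    Finset.mem_union_right _ (Finset.mem_union_right _
      (Finset.mem_image_of_mem _ (Fintype.mem_piFinset.2 ha)))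
  obtain ⟨r, hr, hX⟩ := exists_hom_clique_of_hom_replace_siggersGadget V F hp L hq hGo (by
    intro s hs γ hγ h
    obtain ⟨a, ha, hne⟩ := hV₀ s (fun n R x hx => hs R x fun i =>
      Finset.mem_union_left _ (hx i)) γ hγ
    exact hne (h a ha))
  exact ⟨siggersGadget V F hp L, r, hr, fun X =>
    ⟨nonempty_hom_replace_siggersGadget V F hp L X, hX X⟩⟩

/-! ### Runs of bounded length -/

/-- `b` is reached from `a` in at most `m` steps. -/
def StepsWithin {α : Type*} (f : α → Option α) (a b : α) (m : ℕ) : Prop :=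
  ∃ k ≤ m, (flip bind f)^[k] (some a) = some b

namespace StepsWithin

variable {α : Type*} {f : α → Option α} {a b c : α} {m n : ℕ}

theorem refl (f : α → Option α) (a : α) (m : ℕ) : StepsWithin f a a m :=
  ⟨0, m.zero_le, rfl⟩

theorem head (h : f a = some b) (hb : StepsWithin f b c m) : StepsWithin f a c (m + 1) := by
  obtain ⟨k, hk, hbc⟩ := hb
  refine ⟨k + 1, Nat.succ_le_succ hk, ?_⟩
  rw [Function.iterate_succ_apply]
  exact (congrArg _ h).trans hbc

theorem single (h : f a = some b) : StepsWithin f a b 1 :=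
  head h (refl f b 0)

theorem trans (hab : StepsWithin f a b m) (hbc : StepsWithin f b c n) :
    StepsWithin f a c (m + n) := by
  obtain ⟨k, hk, hab⟩ := hab
  obtain ⟨l, hl, hbc⟩ := hbc
  refine ⟨l + k, by omega, ?_⟩
  rw [Function.iterate_add_apply, hab, hbc]

theorem mono (h : StepsWithin f a b m) (hmn : m ≤ n) : StepsWithin f a b n := by
  obtain ⟨k, hk, h⟩ := h
  exact ⟨k, hk.trans hmn, h⟩

end StepsWithin

/-! ### Running a stack machine as a part of a larger one -/

section JoinStacks

variable {K₁ K₂ : Type} {Γ₁ : K₁ → Type} {Γ₂ : K₂ → Type}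

/-- The contents of the union of two families of stacks. -/
def joinStacks (S₁ : ∀ k, List (Γ₁ k)) (S₂ : ∀ k, List (Γ₂ k)) :
    ∀ k : K₁ ⊕ K₂, List (Sum.elim Γ₁ Γ₂ k)
  | .inl k => S₁ k
  | .inr k => S₂ k

variable [DecidableEq K₁] [DecidableEq K₂]

theorem update_joinStacks_inl (S₁ : ∀ k, List (Γ₁ k)) (S₂ : ∀ k, List (Γ₂ k)) (k : K₁)
    (l : List (Γ₁ k)) :
    Function.update (joinStacks S₁ S₂) (.inl k) l = joinStacks (Function.update S₁ k l) S₂ := by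
  funext k'
  rcases k' with k' | k'
  · by_cases h : k' = k
    · subst h
      exact (Function.update_self _ _ _).trans (Function.update_self _ _ S₁).symm
    · exact (Function.update_of_ne (Sum.inl_injective.ne h) _ _).trans
        (Function.update_of_ne h _ S₁).symm
  · exact Function.update_of_ne Sum.inr_ne_inl _ _

theorem update_joinStacks_inr (S₁ : ∀ k, List (Γ₁ k)) (S₂ : ∀ k, List (Γ₂ k)) (k : K₂)
    (l : List (Γ₂ k)) :
    Function.update (joinStacks S₁ S₂) (.inr k) l = joinStacks S₁ (Function.update S₂ k l) := by
  funext k'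
  rcases k' with k' | k'
  · exact Function.update_of_ne Sum.inl_ne_inr _ _
  · by_cases h : k' = k
    · subst h
      exact (Function.update_self _ _ _).trans (Function.update_self _ _ S₂).symm
    · exact (Function.update_of_ne (Sum.inr_injective.ne h) _ _).trans
        (Function.update_of_ne h _ S₂).symm

end JoinStacks

namespace Turing.TM2

section Extend

variable {K₁ K₂ : Type} {Γ₁ : K₁ → Type} {Γ₂ : K₂ → Type} {Λ₁ Λ₂ σ₁ ρ : Type}

/-- A statement of a machine as a statement of a larger machine, which proceeds to the label `l`
instead of halting. -/
def Stmt.extend (l : Λ₂) :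
    Stmt Γ₁ Λ₁ σ₁ → Stmt (Sum.elim Γ₁ Γ₂) (Λ₁ ⊕ Λ₂) (σ₁ × ρ)
  | .push k f q => .push (.inl k) (fun v => f v.1) (q.extend l)
  | .peek k f q => .peek (.inl k) (fun v x => (f v.1 x, v.2)) (q.extend l)
  | .pop k f q => .pop (.inl k) (fun v x => (f v.1 x, v.2)) (q.extend l)
  | .load f q => .load (fun v => (f v.1, v.2)) (q.extend l)
  | .branch f q₁ q₂ => .branch (fun v => f v.1) (q₁.extend l) (q₂.extend l)
  | .goto f => .goto fun v => .inl (f v.1)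
  | .halt => .goto fun _ => .inr l

/-- A configuration of a machine as a configuration of a larger machine. -/
def Cfg.extend (l : Λ₂) (r : ρ) (S₂ : ∀ k, List (Γ₂ k)) (c : Cfg Γ₁ Λ₁ σ₁) :
    Cfg (Sum.elim Γ₁ Γ₂) (Λ₁ ⊕ Λ₂) (σ₁ × ρ) :=
  ⟨some (c.l.elim (.inr l) .inl), (c.var, r), joinStacks c.stk S₂⟩

variable [DecidableEq K₁] [DecidableEq K₂]

theorem stepAux_extend (l : Λ₂) (r : ρ) (S₂ : ∀ k, List (Γ₂ k)) (q : Stmt Γ₁ Λ₁ σ₁) (v : σ₁)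
    (S₁ : ∀ k, List (Γ₁ k)) :
    stepAux (q.extend l) (v, r) (joinStacks S₁ S₂) = (stepAux q v S₁).extend l r S₂ := by
  induction q generalizing v S₁ with
  | push k f q ih =>
    exact (congrArg (stepAux _ _) (update_joinStacks_inl S₁ S₂ k _)).trans (ih _ _)
  | peek k f q ih => exact ih _ _
  | pop k f q ih =>
    exact (congrArg (stepAux _ _) (update_joinStacks_inl S₁ S₂ k _)).trans (ih _ _)
  | load f q ih => exact ih _ _
  | branch f q₁ q₂ ih₁ ih₂ =>
    rw [Stmt.extend, stepAux, stepAux]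
    cases h : f v
    · exact ih₂ _ _
    · exact ih₁ _ _
  | goto f => rfl
  | halt => rfl

/-- A halted configuration has no successor, so halting can occur only at the end of the run, where
it becomes arrival at `l`. Until then both machines move in step and the additional stacks and state
stay untouched. -/
theorem stepsWithin_extend (M₁ : Λ₁ → Stmt Γ₁ Λ₁ σ₁) (M₂ : Λ₂ → Stmt (Sum.elim Γ₁ Γ₂) (Λ₁ ⊕ Λ₂)
    (σ₁ × ρ)) (l : Λ₂) (r : ρ) (S₂ : ∀ k, List (Γ₂ k)) {c c' : Cfg Γ₁ Λ₁ σ₁} {m : ℕ}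
    (h : StepsWithin (step M₁) c c' m) :
    StepsWithin (step (Sum.elim (fun l₁ => (M₁ l₁).extend l) M₂))
      (c.extend l r S₂) (c'.extend l r S₂) m := by
  obtain ⟨k, hk, h⟩ := h
  refine ⟨k, hk, ?_⟩
  clear hk
  induction k generalizing c with
  | zero => exact congrArg (fun c => some (Cfg.extend l r S₂ c)) (Option.some.inj h)
  | succ k ih =>
    rw [Function.iterate_succ_apply] at h ⊢
    obtain ⟨_ | l₁, v, S⟩ := c
    · have hn : (flip bind (step M₁))^[k] none = none := Function.iterate_fixed rfl k
      exact absurd (hn.symm.trans h) (by simp)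
    · have h1 := ih h
      rw [← h1]
      congr 1
      exact congrArg some (stepAux_extend l r S₂ (M₁ l₁) v S)

end Extend

/-! ### Output length is bounded by running time -/

section PushCount

variable {K : Type} {Γ : K → Type} {Λ σ : Type}

/-- The number of push instructions in a statement. -/
def Stmt.pushCount : Stmt Γ Λ σ → ℕ
  | .push _ _ q => q.pushCount + 1
  | .peek _ _ q => q.pushCount
  | .pop _ _ q => q.pushCount
  | .load _ q => q.pushCount
  | .branch _ q₁ q₂ => q₁.pushCount + q₂.pushCount
  | .goto _ => 0
  | .halt => 0

variable [DecidableEq K]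

theorem length_stk_stepAux_le (q : Stmt Γ Λ σ) (v : σ) (S : ∀ k, List (Γ k)) (k : K) :
    ((stepAux q v S).stk k).length ≤ (S k).length + q.pushCount := by
  induction q generalizing v S with
  | push k' f q ih =>
    refine (ih _ _).trans ?_
    by_cases h : k = k'
    · subst h
      simp [Stmt.pushCount, Nat.add_assoc, Nat.add_comm]
    · simp [Stmt.pushCount, h, ← Nat.add_assoc]
  | peek k' f q ih => exact ih _ _
  | pop k' f q ih =>
    refine (ih _ _).trans ?_
    by_cases h : k = k'
    · subst h
      simp [Stmt.pushCount]
    · simp [Stmt.pushCount, h]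
  | load f q ih => exact ih _ _
  | branch f q₁ q₂ ih₁ ih₂ =>
    rw [stepAux, Stmt.pushCount]
    cases f v
    · exact (ih₂ _ _).trans (by omega)
    · exact (ih₁ _ _).trans (by omega)
  | goto f => exact Nat.le_add_right _ _
  | halt => exact Nat.le_add_right _ _

/-- One step executes a whole statement, which may push several letters; the sum over all labels
bounds the growth per step uniformly. This controls the size of the graph handed to the second
machine. -/
theorem length_stk_le_of_stepsWithin [Fintype Λ] (M : Λ → Stmt Γ Λ σ) {c c' : Cfg Γ Λ σ} {m : ℕ}
    (h : StepsWithin (step M) c c' m) (k : K) :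
    (c'.stk k).length ≤ (c.stk k).length + m * ∑ l, (M l).pushCount := by
  obtain ⟨n, hn, h⟩ := h
  refine le_trans ?_ (Nat.add_le_add_left (Nat.mul_le_mul_right _ hn) _)
  clear hn
  induction n generalizing c with
  | zero =>
    rw [Option.some.inj h]
    exact Nat.le_add_right _ _
  | succ n ih =>
    rw [Function.iterate_succ_apply] at h
    obtain ⟨_ | l, v, S⟩ := c
    · have hn : (flip bind (step M))^[n] none = none := Function.iterate_fixed rfl n
      exact absurd (hn.symm.trans h) (by simp)
    · have h1 := ih h
      have h2 := length_stk_stepAux_le (M l) v S k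
      have h3 : (M l).pushCount ≤ ∑ l, (M l).pushCount :=
        Finset.single_le_sum (f := fun l => (M l).pushCount) (fun _ _ => Nat.zero_le _)
          (Finset.mem_univ l)
      rw [Nat.succ_mul]
      simp only
      omega

end PushCount

end Turing.TM2

/-! ### The machine for gadget replacement -/

/-- The kinds of letters that the machine distinguishes. -/
inductive Token
  | tally
  | sep
  | sym
  deriving DecidableEq

instance : Fintype Token :=
  ⟨{.tally, .sep, .sym}, fun t => by cases t <;> decide⟩

/-- The kind of a letter. -/
def Letter.token {L : FirstOrder.Language.{0, 0}} : Letter L → Token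
  | .tally => .tally
  | .sep => .sep
  | .sym _ => .sym

/-- Whether the last symbol read is a tally mark. -/
def Token.isTally : Option Token → Bool
  | some .tally => true
  | _ => false

/-- The additional stacks: unary counters, an auxiliary counter, and the output. -/
inductive GadgetStack
  | counter (w : Fin 4)
  | scratch
  | out
  deriving DecidableEq, Fintype

/-- The alphabets of the additional stacks. -/
def GadgetStack.alphabet (L : FirstOrder.Language.{0, 0}) : GadgetStack → Type
  | .counter _ => Unit
  | .scratch => Unit
  | .out => Letter L

/-- The labels of the program for the replacement of edges by a gadget that consists of `n` relation
symbols and elements. -/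
inductive GadgetLabel (n : ℕ)
  | header
  | edge
  | readFst
  | readSnd
  | emit (k : Fin (n + 1))
  | copy (k : Fin n)
  | back (k : Fin n)
  | clearFst
  | clearSnd
  | size
  | finish
  deriving Fintype

/-- The relation symbols and elements of a gadget, in the order in which they are written. -/
def Gadget.items {L : FirstOrder.Language.{0, 0}} (g : Gadget L) :
    List ((Σ n, L.Relations n) ⊕ Fin 4 × Fin g.slots) :=
  g.tuples.flatMap fun r => .inl r.1 :: (List.ofFn r.2).map .inr

/-- The word for an item of a gadget, when its elements belong to the objects `v`. -/
def Gadget.itemWord {L : FirstOrder.Language.{0, 0}} (g : Gadget L) (v : Fin 4 → ℕ) :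
    (Σ n, L.Relations n) ⊕ Fin 4 × Fin g.slots → List (Letter L)
  | .inl R => [Letter.sym R]
  | .inr a => encodeUnary L (v a.1 * g.slots + a.2)

namespace Turing.TM2

section GadgetProgram

variable {K₁ : Type} [DecidableEq K₁] {Γ₁ : K₁ → Type} {Λ₁ σ₁ : Type} (k₁ : K₁)
  (φ : Γ₁ k₁ ≃ Letter FirstOrder.Language.graph) {L : FirstOrder.Language.{0, 0}} (g : Gadget L)

/-- The statements of the machine for gadget replacement. -/
abbrev GadgetStmt (Γ₁ : K₁ → Type) (Λ₁ σ₁ : Type) (g : Gadget L) : Type :=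
  Stmt (Sum.elim Γ₁ (GadgetStack.alphabet L)) (Λ₁ ⊕ GadgetLabel g.items.length) (σ₁ × Option Token)

/-- The configurations of the machine for gadget replacement. -/
abbrev GadgetCfg (Γ₁ : K₁ → Type) (Λ₁ σ₁ : Type) (g : Gadget L) : Type :=
  Cfg (Sum.elim Γ₁ (GadgetStack.alphabet L)) (Λ₁ ⊕ GadgetLabel g.items.length) (σ₁ × Option Token)

variable {k₁ g}

/-- Reads a letter of the input. -/
def readInput (q : GadgetStmt Γ₁ Λ₁ σ₁ g) : GadgetStmt Γ₁ Λ₁ σ₁ g :=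
  .pop (.inl k₁) (fun v x => (v.1, x.map fun a => (φ a).token)) q

/-- Decreases a counter. -/
def popCounter (w : Fin 4) (q : GadgetStmt Γ₁ Λ₁ σ₁ g) : GadgetStmt Γ₁ Λ₁ σ₁ g :=
  .pop (.inr (.counter w)) (fun v x => (v.1, x.map fun _ => .tally)) q

/-- Increases a counter. -/
def pushCounter (w : Fin 4) (q : GadgetStmt Γ₁ Λ₁ σ₁ g) : GadgetStmt Γ₁ Λ₁ σ₁ g :=
  .push (.inr (.counter w)) (fun _ => ()) q

/-- Decreases the auxiliary counter. -/
def popScratch (q : GadgetStmt Γ₁ Λ₁ σ₁ g) : GadgetStmt Γ₁ Λ₁ σ₁ g :=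
  .pop (.inr .scratch) (fun v x => (v.1, x.map fun _ => .tally)) q

/-- Increases the auxiliary counter. -/
def pushScratch (q : GadgetStmt Γ₁ Λ₁ σ₁ g) : GadgetStmt Γ₁ Λ₁ σ₁ g :=
  .push (.inr .scratch) (fun _ => ()) q

/-- Writes a letter. -/
def pushOut (a : Letter L) (q : GadgetStmt Γ₁ Λ₁ σ₁ g) : GadgetStmt Γ₁ Λ₁ σ₁ g :=
  .push (.inr .out) (fun _ => a) q

/-- Writes tally marks. -/
def pushTallies (m : ℕ) (q : GadgetStmt Γ₁ Λ₁ σ₁ g) : GadgetStmt Γ₁ Λ₁ σ₁ g :=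
  (pushOut .tally)^[m] q

/-- Proceeds to one of two labels, depending on whether a tally mark has been read. -/
def ifTally (q₁ q₂ : GadgetStmt Γ₁ Λ₁ σ₁ g) : GadgetStmt Γ₁ Λ₁ σ₁ g :=
  .branch (fun v => Token.isTally v.2) q₁ q₂

/-- Forgets the symbol that has been read and proceeds to a label. -/
def jump (l : GadgetLabel g.items.length) : GadgetStmt Γ₁ Λ₁ σ₁ g :=
  .load (fun v => (v.1, none)) (.goto fun _ => .inr l)

/-- The counter of an item. -/
def itemCounter (a : (Σ n, L.Relations n) ⊕ Fin 4 × Fin g.slots) : Fin 4 :=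
  a.elim (fun _ => 3) Prod.fst

/-- Writes the part of an item that does not depend on the counters. -/
def emitItem (k : Fin g.items.length) :
    (Σ n, L.Relations n) ⊕ Fin 4 × Fin g.slots → GadgetStmt Γ₁ Λ₁ σ₁ g
  | .inl R => pushOut (.sym R) (jump (.emit k.succ))
  | .inr a => pushOut .sep (pushTallies a.2 (jump (.copy k)))

/-- The items of a gadget in the reverse order, in which they are pushed to the output. -/
def revItem (g : Gadget L) (k : Fin g.items.length) :
    (Σ n, L.Relations n) ⊕ Fin 4 × Fin g.slots :=
  g.items.get k.rev

variable (g)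

/-- The program for gadget replacement. -/
def gadgetProgram : GadgetLabel g.items.length → GadgetStmt Γ₁ Λ₁ σ₁ g
  -- Counter 2 first counts the vertices, so it then holds the number of the first edge; `.clearSnd`
  -- increments it for the next one. Counter 3 stays zero between items and stands for the shared
  -- object.
  | .header => readInput φ (ifTally (pushCounter 2 (jump .header)) (jump .edge))
  | .edge => readInput φ (.branch (fun v => v.2.isSome) (jump .readFst) (jump .size))
  | .readFst => readInput φ (ifTally (pushCounter 0 (jump .readFst)) (jump .readSnd))
  | .readSnd => readInput φ (ifTally (pushCounter 1 (jump .readSnd)) (jump (.emit 0)))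
  | .emit k => if h : k.1 < g.items.length then emitItem ⟨k.1, h⟩ (revItem g ⟨k.1, h⟩)
      else jump .clearFst
  -- Reading a counter destroys it: each unit yields `g.slots` tally marks and is saved on the
  -- scratch stack, from which `.back` restores it.
  | .copy k => popCounter (itemCounter (revItem g k))
      (ifTally (pushScratch (pushTallies g.slots (jump (.copy k)))) (jump (.back k)))
  | .back k => popScratch (ifTally (pushCounter (itemCounter (revItem g k)) (jump (.back k)))
      (jump (.emit k.succ)))
  | .clearFst => popCounter 0 (ifTally (jump .clearFst) (jump .clearSnd))
  | .clearSnd => popCounter 1 (ifTally (jump .clearSnd) (pushCounter 2 (jump .edge)))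
  | .size => pushOut .sep (jump .finish)
  -- Counter 2 now holds the number of vertices plus edges, so the domain size comes out last and
  -- ends up on top of the output.
  | .finish => popCounter 2 (ifTally (pushTallies g.slots (jump .finish)) .halt)

/-- The additional stacks with given contents. -/
def gadgetStacks (L : FirstOrder.Language.{0, 0}) (v : Fin 4 → ℕ) (s : ℕ) (o : List (Letter L)) :
    ∀ k, List (GadgetStack.alphabet L k)
  | .counter w => List.replicate (v w) ()
  | .scratch => List.replicate s ()
  | .out => o

/-- All stacks, with the input on the stack `k₁`. -/
def allStacks (inp : List (Letter FirstOrder.Language.graph)) (v : Fin 4 → ℕ) (s : ℕ)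
    (o : List (Letter L)) : ∀ k, List (Sum.elim Γ₁ (GadgetStack.alphabet L) k) :=
  joinStacks (Function.update (fun _ => []) k₁ (inp.map φ.symm)) (gadgetStacks L v s o)

/-- A configuration at a label of the program for gadget replacement. -/
def gadgetCfg (i : σ₁) (l : Option (GadgetLabel g.items.length))
    (inp : List (Letter FirstOrder.Language.graph)) (v : Fin 4 → ℕ) (s : ℕ) (o : List (Letter L)) :
    GadgetCfg Γ₁ Λ₁ σ₁ g :=
  ⟨l.map .inr, (i, none), allStacks φ inp v s o⟩

theorem update_gadgetStacks_counter (v : Fin 4 → ℕ) (s : ℕ) (o : List (Letter L)) (w : Fin 4)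
    (x : ℕ) : Function.update (gadgetStacks L v s o) (.counter w) (List.replicate x ()) =
      gadgetStacks L (Function.update v w x) s o := by
  funext k
  rcases k with w' | _ | _
  · by_cases h : w' = w
    · subst h
      refine (Function.update_self _ _ _).trans ?_
      exact (congrArg (fun x => List.replicate x ()) (Function.update_self _ _ v)).symm
    · refine (Function.update_of_ne (fun h' => h (GadgetStack.counter.inj h')) _ _).trans ?_
      exact (congrArg (fun x => List.replicate x ()) (Function.update_of_ne h _ v)).symm
  · exact Function.update_of_ne (fun h => by cases h) _ _
  · exact Function.update_of_ne (fun h => by cases h) _ _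

theorem update_gadgetStacks_scratch (v : Fin 4 → ℕ) (s : ℕ) (o : List (Letter L))
    (x : ℕ) : Function.update (gadgetStacks L v s o) .scratch (List.replicate x ()) =
      gadgetStacks L v x o := by
  funext k
  rcases k with w' | _ | _
  · exact Function.update_of_ne (fun h => by cases h) _ _
  · exact Function.update_self _ _ _
  · exact Function.update_of_ne (fun h => by cases h) _ _

theorem update_gadgetStacks_out (v : Fin 4 → ℕ) (s : ℕ) (o o' : List (Letter L)) :
    Function.update (gadgetStacks L v s o) .out o' = gadgetStacks L v s o' := by
  funext k
  rcases k with w' | _ | _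
  · exact Function.update_of_ne (fun h => by cases h) _ _
  · exact Function.update_of_ne (fun h => by cases h) _ _
  · exact Function.update_self _ _ _

/-! ### Effect of single instructions on the stacks -/

section StepAux

variable (i : σ₁) (r : Option Token) (inp : List (Letter FirstOrder.Language.graph))
  (v : Fin 4 → ℕ) (s : ℕ) (o : List (Letter L)) (q : GadgetStmt Γ₁ Λ₁ σ₁ g)

theorem stepAux_readInput :
    stepAux (readInput φ q) (i, r) (allStacks φ inp v s o) =
      stepAux q (i, inp.head?.map Letter.token) (allStacks φ inp.tail v s o) := by
  have h0 : allStacks φ inp v s o (.inl k₁) = inp.map φ.symm :=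
    Function.update_self (β := fun k => List (Γ₁ k)) k₁ (inp.map φ.symm) fun _ => []
  have h1 : Function.update (allStacks φ inp v s o) (.inl k₁) (inp.map φ.symm).tail =
      allStacks φ inp.tail v s o := by
    refine (update_joinStacks_inl _ _ _ _).trans ?_
    rw [Function.update_idem, ← List.map_tail]
    rfl
  have h2 : (inp.map φ.symm).head?.map (fun a => (φ a).token) = inp.head?.map Letter.token := by
    cases inp <;> simp
  rw [← h1, ← h2, ← h0]
  rfl

theorem stepAux_popCounter_succ (w : Fin 4) (x : ℕ) :
    stepAux (popCounter w q) (i, r) (allStacks φ inp (Function.update v w (x + 1)) s o) =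
      stepAux q (i, some .tally) (allStacks φ inp (Function.update v w x) s o) := by
  have h0 : allStacks φ inp (Function.update v w (x + 1)) s o (.inr (.counter w)) =
      List.replicate (x + 1) () :=
    congrArg (fun x => List.replicate x ()) (Function.update_self _ _ v)
  have h1 : Function.update (allStacks φ inp (Function.update v w (x + 1)) s o)
      (.inr (.counter w)) (List.replicate x ()) =
        allStacks φ inp (Function.update v w x) s o := by
    refine (update_joinStacks_inr _ _ _ _).trans ?_
    refine congrArg _ ((update_gadgetStacks_counter _ s o w x).trans ?_)
    rw [Function.update_idem]
  rw [← h1]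
  change stepAux q (i, Option.map _ (List.head? (allStacks φ inp _ s o (.inr (.counter w)))))
    (Function.update _ _ (List.tail (allStacks φ inp _ s o (.inr (.counter w))))) = _
  rw [h0]
  rfl

theorem stepAux_popCounter_zero (w : Fin 4) (hw : v w = 0) :
    stepAux (popCounter w q) (i, r) (allStacks φ inp v s o) =
      stepAux q (i, none) (allStacks φ inp v s o) := by
  have h0 : allStacks φ inp v s o (.inr (.counter w)) = List.replicate 0 () :=
    congrArg (fun x => List.replicate x ()) hw
  have h1 : Function.update (allStacks φ inp v s o)
      (.inr (.counter w)) (List.replicate 0 ()) = allStacks φ inp v s o := by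
    exact (congrArg _ h0.symm).trans (Function.update_eq_self _ _)
  change stepAux q (i, Option.map _ (List.head? (allStacks φ inp _ s o (.inr (.counter w)))))
    (Function.update _ _ (List.tail (allStacks φ inp _ s o (.inr (.counter w))))) = _
  rw [h0]
  exact congrArg (stepAux q (i, none)) h1

theorem stepAux_pushCounter (w : Fin 4) :
    stepAux (pushCounter w q) (i, r) (allStacks φ inp v s o) =
      stepAux q (i, r) (allStacks φ inp (Function.update v w (v w + 1)) s o) := by
  refine congrArg (stepAux q (i, r)) ((update_joinStacks_inr _ _ _ _).trans ?_)
  exact congrArg _ (update_gadgetStacks_counter v s o w (v w + 1))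

theorem stepAux_popScratch_succ :
    stepAux (popScratch q) (i, r) (allStacks φ inp v (s + 1) o) =
      stepAux q (i, some .tally) (allStacks φ inp v s o) := by
  refine congrArg (stepAux q (i, _)) ((update_joinStacks_inr _ _ _ _).trans ?_)
  exact congrArg _ (update_gadgetStacks_scratch v (s + 1) o s)

theorem stepAux_popScratch_zero :
    stepAux (popScratch q) (i, r) (allStacks φ inp v 0 o) =
      stepAux q (i, none) (allStacks φ inp v 0 o) := by
  refine congrArg (stepAux q (i, _)) ((update_joinStacks_inr _ _ _ _).trans ?_)
  exact congrArg _ (update_gadgetStacks_scratch v 0 o 0)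

theorem stepAux_pushScratch :
    stepAux (pushScratch q) (i, r) (allStacks φ inp v s o) =
      stepAux q (i, r) (allStacks φ inp v (s + 1) o) := by
  refine congrArg (stepAux q (i, r)) ((update_joinStacks_inr _ _ _ _).trans ?_)
  exact congrArg _ (update_gadgetStacks_scratch v s o (s + 1))

theorem stepAux_pushOut (a : Letter L) :
    stepAux (pushOut a q) (i, r) (allStacks φ inp v s o) =
      stepAux q (i, r) (allStacks φ inp v s (a :: o)) := by
  refine congrArg (stepAux q (i, r)) ((update_joinStacks_inr _ _ _ _).trans ?_)
  exact congrArg _ (update_gadgetStacks_out v s o (a :: o))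

theorem stepAux_pushTallies (m : ℕ) :
    stepAux (pushTallies m q) (i, r) (allStacks φ inp v s o) =
      stepAux q (i, r) (allStacks φ inp v s (List.replicate m .tally ++ o)) := by
  induction m generalizing o with
  | zero => rfl
  | succ m ih =>
    rw [pushTallies, Function.iterate_succ_apply', stepAux_pushOut]
    refine (ih _).trans ?_
    rw [List.replicate_succ', List.append_assoc]
    rfl

end StepAux

end GadgetProgram

end Turing.TM2

/-! ### Correctness and running time of the gadget program -/

namespace Turing.TM2

section GadgetRun

variable {K₁ : Type} [DecidableEq K₁] {Γ₁ : K₁ → Type} {Λ₁ σ₁ : Type} {k₁ : K₁}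
  (φ : Γ₁ k₁ ≃ Letter FirstOrder.Language.graph) {L : FirstOrder.Language.{0, 0}} (g : Gadget L)
  (M₁ : Λ₁ → Stmt Γ₁ Λ₁ σ₁)

/-- The machine that runs a given machine and applies gadget replacement to its output. -/
def gadgetMachine : Λ₁ ⊕ GadgetLabel g.items.length → GadgetStmt Γ₁ Λ₁ σ₁ g :=
  Sum.elim (fun l => (M₁ l).extend .header) (gadgetProgram φ g)

variable (i : σ₁) (inp : List (Letter FirstOrder.Language.graph))
  (v : Fin 4 → ℕ) (s : ℕ) (o : List (Letter L))

theorem stepAux_pushCounter_update (r : Option Token) (w : Fin 4) (x : ℕ)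
    (q : GadgetStmt Γ₁ Λ₁ σ₁ g) :
    stepAux (pushCounter w q) (i, r) (allStacks φ inp (Function.update v w x) s o) =
      stepAux q (i, r) (allStacks φ inp (Function.update v w (x + 1)) s o) := by
  rw [stepAux_pushCounter, Function.update_idem, Function.update_self]

theorem stepsWithin_read {l l' : GadgetLabel g.items.length} {w : Fin 4}
    (hl : gadgetProgram φ g (Λ₁ := Λ₁) (σ₁ := σ₁) l =
      readInput φ (ifTally (pushCounter w (jump l)) (jump l'))) (n x : ℕ) :
    StepsWithin (step (gadgetMachine φ g M₁))
      (gadgetCfg φ g i (some l) (List.replicate n .tally ++ .sep :: inp)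
        (Function.update v w x) s o)
      (gadgetCfg φ g i (some l') inp (Function.update v w (x + n)) s o) (n + 1) := by
  induction n generalizing x with
  | zero =>
    refine .single (congrArg some ?_)
    refine (congrArg (fun q => stepAux q _ _) hl).trans ?_
    exact stepAux_readInput φ g i none _ _ s o _
  | succ n ih =>
    have h := ih (x + 1)
    rw [Nat.add_assoc, Nat.add_comm 1] at h
    refine .head (congrArg some ?_) h
    refine (congrArg (fun q => stepAux q _ _) hl).trans ?_
    refine (stepAux_readInput φ g i none _ _ s o _).trans ?_
    exact stepAux_pushCounter_update φ g i _ v s o (some .tally) w x (jump l)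

/-- All loops that exhaust a counter have this shape: copying takes d = 1 and m = `g.slots`,
clearing takes d = m = 0, and writing the domain size takes d = 0 and m = `g.slots`. -/
theorem stepsWithin_countdown {l : GadgetLabel g.items.length} {w : Fin 4} {d m : ℕ}
    {q₁ q₂ : GadgetStmt Γ₁ Λ₁ σ₁ g} (hl : gadgetProgram φ g l = popCounter w (ifTally q₁ q₂))
    (hq : ∀ x s o, stepAux q₁ (i, some .tally) (allStacks φ inp (Function.update v w x) s o) =
      gadgetCfg φ g i (some l) inp (Function.update v w x) (s + d)
        (List.replicate m .tally ++ o)) (x : ℕ) :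
    StepsWithin (step (gadgetMachine φ g M₁))
      (gadgetCfg φ g i (some l) inp (Function.update v w x) s o)
      (stepAux q₂ (i, none) (allStacks φ inp (Function.update v w 0) (s + x * d)
        (List.replicate (x * m) .tally ++ o))) (x + 1) := by
  induction x generalizing s o with
  | zero =>
    refine .single (congrArg some ?_)
    refine (congrArg (fun q => stepAux q _ _) hl).trans ?_
    rw [Nat.zero_mul, Nat.zero_mul]
    exact stepAux_popCounter_zero φ g i none inp _ s o _ w (Function.update_self _ _ v)
  | succ x ih =>
    have h := ih (s + d) (List.replicate m .tally ++ o)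
    have h1 : s + d + x * d = s + (x + 1) * d := by ring
    rw [h1, ← List.append_assoc, List.replicate_append_replicate, ← Nat.succ_mul] at h
    refine .head (congrArg some ?_) h
    refine (congrArg (fun q => stepAux q _ _) hl).trans ?_
    refine (stepAux_popCounter_succ φ g i none inp v s o _ w x).trans ?_
    exact hq x s o

theorem stepsWithin_back (k : Fin g.items.length) (x : ℕ) :
    StepsWithin (step (gadgetMachine φ g M₁))
      (gadgetCfg φ g i (some (.back k)) inp
        (Function.update v (itemCounter (revItem g k)) x) s o)
      (gadgetCfg φ g i (some (.emit k.succ)) inp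
        (Function.update v (itemCounter (revItem g k)) (x + s)) 0 o) (s + 1) := by
  induction s generalizing x with
  | zero =>
    exact .single (congrArg some (stepAux_popScratch_zero φ g i none inp _ o _))
  | succ s ih =>
    have h := ih (x + 1)
    rw [Nat.add_right_comm] at h
    refine .head (congrArg some ?_) h
    refine (stepAux_popScratch_succ φ g i none inp _ s o _).trans ?_
    exact stepAux_pushCounter_update φ g i inp v s o (some .tally) _ x (jump (.back k))

/-- With counter value x ≤ N, an element costs one step for its fixed part and x + 1 steps each for
copying and restoring. -/
theorem stepsWithin_emit {N : ℕ} (hv : ∀ w, v w ≤ N) (k : Fin g.items.length) :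
    StepsWithin (step (gadgetMachine φ g M₁))
      (gadgetCfg φ g i (some (.emit k.castSucc)) inp v 0 o)
      (gadgetCfg φ g i (some (.emit k.succ)) inp v 0 (g.itemWord v (revItem g k) ++ o))
      (2 * N + 3) := by
  have hprog : gadgetProgram φ g (Λ₁ := Λ₁) (σ₁ := σ₁) (.emit k.castSucc) =
      emitItem k (revItem g k) := dif_pos k.isLt
  rcases hk : revItem g k with R | a
  · rw [hk] at hprog
    refine StepsWithin.mono (m := 1) (.single (congrArg some ?_)) (by omega)
    refine (congrArg (fun q => stepAux q _ _) hprog).trans ?_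
    exact stepAux_pushOut φ g i none inp v 0 o _ _
  · rw [hk] at hprog
    have hw : itemCounter (revItem g k) = a.1 := by rw [hk]; rfl
    have h1 : step (gadgetMachine φ g M₁)
        (gadgetCfg φ g i (some (.emit k.castSucc)) inp v 0 o) =
        some (gadgetCfg φ g i (some (.copy k)) inp v 0
          (List.replicate a.2.1 .tally ++ .sep :: o)) := by
      refine congrArg some ((congrArg (fun q => stepAux q _ _) hprog).trans ?_)
      refine (stepAux_pushOut φ g i none inp v 0 o _ _).trans ?_
      exact stepAux_pushTallies φ g i none inp v 0 _ _ _
    have h2 := stepsWithin_countdown φ g M₁ i inp v 0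
      (List.replicate a.2.1 .tally ++ .sep :: o) (l := .copy k)
      (w := itemCounter (revItem g k)) (d := 1) (m := g.slots) rfl (fun x s o =>
        (stepAux_pushScratch φ g i _ inp _ s o _).trans
          (stepAux_pushTallies φ g i _ inp _ (s + 1) o _ _)) (v a.1)
    have h3 := stepsWithin_back φ g M₁ i inp v (v a.1)
      (List.replicate (v a.1 * g.slots) .tally ++ (List.replicate a.2.1 .tally ++ .sep :: o)) k 0
    rw [Nat.zero_add, hw, Function.update_eq_self, ← List.append_assoc,
      List.replicate_append_replicate] at h3
    rw [Nat.zero_add, Nat.mul_one, hw, Function.update_eq_self, ← List.append_assoc,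
      List.replicate_append_replicate] at h2
    have h4 := (StepsWithin.head h1 (h2.trans h3)).mono (n := 2 * N + 3) (by
      have := hv a.1
      omega)
    simpa [Gadget.itemWord, encodeUnary] using h4

/-- Items are pushed from the last to the first, so j counts those still to be written, and they
form a prefix of the list. -/
theorem stepsWithin_emit_all {N : ℕ} (hv : ∀ w, v w ≤ N) (j : ℕ) (hj : j ≤ g.items.length) :
    StepsWithin (step (gadgetMachine φ g M₁))
      (gadgetCfg φ g i (some (.emit ⟨g.items.length - j, by omega⟩)) inp v 0 o)
      (gadgetCfg φ g i (some (.emit (Fin.last _))) inp v 0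
        ((g.items.take j).flatMap (g.itemWord v) ++ o)) (j * (2 * N + 3)) := by
  induction j generalizing o with
  | zero => exact .refl _ _ _
  | succ j ih =>
    have hlt : g.items.length - (j + 1) < g.items.length := by omega
    have h1 := stepsWithin_emit φ g M₁ i inp v o hv ⟨g.items.length - (j + 1), hlt⟩
    have hs : (⟨g.items.length - (j + 1), hlt⟩ : Fin _).succ =
        ⟨g.items.length - j, by omega⟩ := Fin.ext (by simp only [Fin.val_succ]; omega)
    have hr : revItem g ⟨g.items.length - (j + 1), hlt⟩ = g.items[j] := by
      refine congrArg g.items.get (Fin.ext (b := ⟨j, hj⟩) ?_)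
      rw [Fin.val_rev]
      dsimp only
      omega
    rw [hs, hr] at h1
    have h2 := h1.trans (ih (g.itemWord v g.items[j] ++ o) (by omega))
    have h3 : (g.items.take (j + 1)).flatMap (g.itemWord v) ++ o =
        (g.items.take j).flatMap (g.itemWord v) ++ (g.itemWord v g.items[j] ++ o) := by
      rw [← List.take_append_getElem hj, List.flatMap_append, List.append_assoc]
      simp
    rw [h3]
    exact h2.mono (by rw [Nat.succ_mul j, Nat.add_comm])

/-- The word for an edge. -/
def edgeWord {m : ℕ}
    (x : Σ R : (Σ n, FirstOrder.Language.graph.Relations n), (Fin R.1 → Fin m)) :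
    List (Letter FirstOrder.Language.graph) :=
  Letter.sym x.1 :: (List.ofFn x.2).flatMap fun i => encodeUnary _ i.val

theorem edgeWord_eq {m : ℕ}
    (x : Σ R : (Σ n, FirstOrder.Language.graph.Relations n), (Fin R.1 → Fin m)) :
    edgeWord x = Letter.sym x.1 :: (encodeUnary _ (edgeEnd x 0).val ++
      encodeUnary _ (edgeEnd x 1).val) := by
  obtain ⟨⟨_, ⟨⟩⟩, x⟩ := x
  simp [edgeWord, edgeEnd, List.ofFn_succ]

/-- A bound on the number of steps taken for an edge. -/
def edgeTime (g : Gadget L) (N : ℕ) : ℕ := g.items.length * (2 * N + 3) + 4 * N + 6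

theorem update_vec_zero (a b c d x : ℕ) :
    Function.update ![a, b, c, d] 0 x = ![x, b, c, d] := by
  funext w
  fin_cases w <;> rfl

theorem update_vec_one (a b c d x : ℕ) :
    Function.update ![a, b, c, d] 1 x = ![a, x, c, d] := by
  funext w
  fin_cases w <;> rfl

theorem update_vec_two (a b c d x : ℕ) :
    Function.update ![a, b, c, d] 2 x = ![a, b, x, d] := by
  funext w
  fin_cases w <;> rfl

theorem stepsWithin_edge {m N t : ℕ}
    (x : Σ R : (Σ n, FirstOrder.Language.graph.Relations n), (Fin R.1 → Fin m))
    (hm : m ≤ N) (ht : t ≤ N) :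
    StepsWithin (step (gadgetMachine φ g M₁))
      (gadgetCfg φ g i (some .edge) (edgeWord x ++ inp) ![0, 0, t, 0] 0 o)
      (gadgetCfg φ g i (some .edge) inp ![0, 0, t + 1, 0] 0
        (g.items.flatMap (g.itemWord (edgeCounters x t)) ++ o)) (edgeTime g N) := by
  have hx0 := (edgeEnd x 0).isLt
  have hx1 := (edgeEnd x 1).isLt
  set a := (edgeEnd x 0).val with ha
  set b := (edgeEnd x 1).val with hb
  have hv : edgeCounters x t = ![a, b, t, 0] := rfl
  have h0 : step (gadgetMachine φ g M₁)
      (gadgetCfg φ g i (some .edge) (edgeWord x ++ inp) ![0, 0, t, 0] 0 o) =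
      some (gadgetCfg φ g i (some .readFst) (List.replicate a .tally ++ .sep ::
        (List.replicate b .tally ++ .sep :: inp)) ![0, 0, t, 0] 0 o) := by
    have hw : edgeWord x ++ inp = .sym x.1 :: (List.replicate a .tally ++ .sep ::
        (List.replicate b .tally ++ .sep :: inp)) := by
      simp [edgeWord_eq, encodeUnary, ha, hb]
    rw [hw]
    exact congrArg some (stepAux_readInput φ g i none _ _ 0 o _)
  have h1 := stepsWithin_read φ g M₁ i (List.replicate b .tally ++ .sep :: inp)
    ![0, 0, t, 0] 0 o (l := .readFst) (l' := .readSnd) (w := 0) rfl a 0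
  have h2 := stepsWithin_read φ g M₁ i inp
    ![a, 0, t, 0] 0 o (l := .readSnd) (l' := .emit 0) (w := 1) rfl b 0
  have h3 := stepsWithin_emit_all φ g M₁ i inp ![a, b, t, 0] o (N := N)
    (by intro w; fin_cases w <;> simp <;> omega) g.items.length le_rfl
  have h4 : step (gadgetMachine φ g M₁) (gadgetCfg φ g i (some (.emit (Fin.last _))) inp
      ![a, b, t, 0] 0 (g.items.flatMap (g.itemWord ![a, b, t, 0]) ++ o)) =
      some (gadgetCfg φ g i (some .clearFst) inp
      ![a, b, t, 0] 0 (g.items.flatMap (g.itemWord ![a, b, t, 0]) ++ o)) := by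
    refine congrArg some (congrArg (fun q => stepAux q _ _) (?_ :
      gadgetProgram φ g (.emit (Fin.last _)) = jump .clearFst))
    exact dif_neg (lt_irrefl _)
  have h5 := stepsWithin_countdown φ g M₁ i inp ![a, b, t, 0] 0
    (g.items.flatMap (g.itemWord ![a, b, t, 0]) ++ o) (l := .clearFst) (w := 0) (d := 0) (m := 0)
    rfl (fun x s o => rfl) a
  have h6 := stepsWithin_countdown φ g M₁ i inp ![0, b, t, 0] 0
    (g.items.flatMap (g.itemWord ![a, b, t, 0]) ++ o) (l := .clearSnd) (w := 1) (d := 0) (m := 0)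
    rfl (fun x s o => rfl) b
  rw [update_vec_zero, update_vec_zero, Nat.zero_add] at h1
  rw [update_vec_one, update_vec_one, Nat.zero_add] at h2
  rw [update_vec_zero, update_vec_zero, Nat.mul_zero] at h5
  rw [update_vec_one, update_vec_one, Nat.mul_zero] at h6
  have h7 := (StepsWithin.single h4).trans (h5.trans h6)
  rw [List.take_length] at h3
  have hz : (⟨g.items.length - g.items.length, by omega⟩ : Fin (g.items.length + 1)) = 0 :=
    Fin.ext (Nat.sub_self _)
  rw [hz] at h3
  have h8 : stepAux (pushCounter (Λ₁ := Λ₁) 2 (jump .edge)) (i, none)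
      (allStacks φ inp ![0, 0, t, 0] (0 + 0)
        (List.replicate 0 .tally ++ (g.items.flatMap (g.itemWord ![a, b, t, 0]) ++ o))) =
      gadgetCfg φ g i (some .edge) inp ![0, 0, t + 1, 0] 0
        (g.items.flatMap (g.itemWord ![a, b, t, 0]) ++ o) := by
    rw [stepAux_pushCounter, update_vec_two]
    rfl
  rw [h8] at h7
  rw [hv]
  refine (StepsWithin.head h0 (h1.trans (h2.trans (h3.trans h7)))).mono ?_
  rw [edgeTime]
  omega

/-- The run on the edges of a graph, from the moment when the vertices have been counted. -/
theorem stepsWithin_edges {m N t : ℕ}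
    (es : List (Σ R : (Σ n, FirstOrder.Language.graph.Relations n), (Fin R.1 → Fin m)))
    (hm : m ≤ N) (ht : t + es.length ≤ N) :
    StepsWithin (step (gadgetMachine φ g M₁))
      (gadgetCfg φ g i (some .edge) (es.flatMap edgeWord) ![0, 0, t, 0] 0 o)
      (gadgetCfg φ g i none [] ![0, 0, 0, 0] 0
        (encodeUnary L ((t + es.length) * g.slots) ++
          ((es.zipIdx t).reverse.flatMap fun e =>
            g.items.flatMap (g.itemWord (edgeCounters e.1 e.2))) ++ o))
      (es.length * edgeTime g N + (N + 3)) := by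
  induction es generalizing t o with
  | nil =>
    have h0 : step (gadgetMachine φ g M₁) (gadgetCfg φ g i (some .edge) [] ![0, 0, t, 0] 0 o) =
        some (gadgetCfg φ g i (some .size) [] ![0, 0, t, 0] 0 o) :=
      congrArg some (stepAux_readInput φ g i none _ _ 0 o _)
    have h1 : step (gadgetMachine φ g M₁) (gadgetCfg φ g i (some .size) [] ![0, 0, t, 0] 0 o) =
        some (gadgetCfg φ g i (some .finish) [] ![0, 0, t, 0] 0 (.sep :: o)) :=
      congrArg some (stepAux_pushOut φ g i none [] _ 0 o _ _)
    have h2 := stepsWithin_countdown φ g M₁ i [] ![0, 0, t, 0] 0 (.sep :: o) (l := .finish)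
      (w := 2) (d := 0) (m := g.slots) rfl (fun x s o =>
        stepAux_pushTallies φ g i _ [] _ s o _ _) t
    rw [update_vec_two, update_vec_two] at h2
    have h3 := (StepsWithin.head h0 (.head h1 h2)).mono (n := N + 3) (by
      have : t ≤ N := ht
      omega)
    rw [List.length_nil, Nat.zero_mul, Nat.zero_add]
    have h4 : encodeUnary L ((t + 0) * g.slots) ++
        (([] : List ((Σ R : (Σ n, FirstOrder.Language.graph.Relations n),
          (Fin R.1 → Fin m)) × ℕ)).reverse.flatMap fun e =>
            g.items.flatMap (g.itemWord (edgeCounters e.1 e.2))) ++ o =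
        List.replicate (t * g.slots) .tally ++ .sep :: o := by
      simp [encodeUnary]
    rw [List.zipIdx_nil, h4]
    exact h3
  | cons x es ih =>
    rw [List.length_cons] at ht
    have h1 := stepsWithin_edge φ g M₁ i (es.flatMap edgeWord) o x hm (by omega : t ≤ N)
    have h2 := h1.trans (ih (g.items.flatMap (g.itemWord (edgeCounters x t)) ++ o)
      (t := t + 1) (by omega))
    have h3 : t + 1 + es.length = t + (x :: es).length := by rw [List.length_cons]; omega
    have h4 : (((x :: es).zipIdx t).reverse.flatMap fun e =>
        g.items.flatMap (g.itemWord (edgeCounters e.1 e.2))) ++ o =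
        ((es.zipIdx (t + 1)).reverse.flatMap fun e =>
          g.items.flatMap (g.itemWord (edgeCounters e.1 e.2))) ++
          (g.items.flatMap (g.itemWord (edgeCounters x t)) ++ o) := by
      rw [List.zipIdx_cons, List.reverse_cons, List.flatMap_append, List.append_assoc]
      simp
    rw [List.append_assoc, h3, ← h4, ← List.append_assoc] at h2
    refine h2.mono ?_
    rw [List.length_cons, Nat.succ_mul]
    omega

theorem encode_eq (X : FinInstance FirstOrder.Language.graph) :
    X.encode = List.replicate X.size .tally ++ .sep :: X.tuples.flatMap edgeWord := by
  rw [FinInstance.encode, encodeUnary, List.append_assoc]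
  rfl

/-- Flattening the gadget into items commutes with substituting the counters, so the encoding is the
word that the program leaves on its output stack. -/
theorem encode_replace (X : FinInstance FirstOrder.Language.graph) :
    (g.replace X).encode = encodeUnary L ((X.size + X.tuples.length) * g.slots) ++
      (X.tuples.zipIdx X.size).reverse.flatMap fun e =>
        g.items.flatMap (g.itemWord (edgeCounters e.1 e.2)) := by
  have h (e : (Σ R : (Σ n, FirstOrder.Language.graph.Relations n), (Fin R.1 → Fin X.size)) × ℕ)
      (he : e ∈ X.tuples.zipIdx X.size) :
      ((g.tuples.map fun r => (⟨r.1, fun i => ⟨edgeCounters e.1 e.2 (r.2 i).1 * g.slots + (r.2 i).2,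
        mul_add_lt_mul (edgeCounters_lt e.1 (lt_of_mem_zipIdx he) _) (r.2 i).2.isLt⟩⟩ :
          Σ R : (Σ n, L.Relations n), (Fin R.1 → Fin (g.replace X).size))).flatMap fun t =>
            Letter.sym t.1 :: (List.ofFn t.2).flatMap fun i => encodeUnary L i.val) =
        g.items.flatMap (g.itemWord (edgeCounters e.1 e.2)) := by
    rw [Gadget.items, List.flatMap_assoc, List.flatMap_map]
    refine List.flatMap_congr fun r _ => ?_
    rw [List.flatMap_cons, List.flatMap_map]
    refine congrArg (Letter.sym r.1 :: ·) ?_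
    rw [List.ofFn_eq_map, List.flatMap_map, List.ofFn_eq_map, List.flatMap_map]
    rfl
  refine congrArg (encodeUnary L _ ++ ·) ?_
  refine List.flatMap_assoc.trans ?_
  have h1 : ∀ e ∈ (X.tuples.zipIdx X.size).attach.reverse, _ = _ := fun e _ => h e.1 e.2
  refine (List.flatMap_congr h1).trans ?_
  have h2 : (X.tuples.zipIdx X.size).attach.reverse.map Subtype.val =
      (X.tuples.zipIdx X.size).reverse := by
    rw [List.map_reverse, List.attach_map_subtype_val]
  rw [← h2, List.flatMap_map]

theorem length_tuples_le_length_encode (X : FinInstance FirstOrder.Language.graph) :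
    X.size + X.tuples.length ≤ X.encode.length := by
  have h : X.tuples.length ≤ (X.tuples.flatMap edgeWord).length := by
    generalize X.tuples = l
    induction l with
    | nil => simp
    | cons x l ih =>
      rw [List.flatMap_cons, List.length_append, List.length_cons, edgeWord, List.length_cons]
      omega
  rw [encode_eq, List.length_append, List.length_replicate, List.length_cons]
  omega

/-- The program for gadget replacement computes gadget replacement. -/
theorem stepsWithin_gadgetProgram {N : ℕ} (X : FinInstance FirstOrder.Language.graph)
    (hN : X.encode.length ≤ N) :
    StepsWithin (step (gadgetMachine φ g M₁))
      (gadgetCfg φ g i (some .header) X.encode ![0, 0, 0, 0] 0 [])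
      (gadgetCfg φ g i none [] ![0, 0, 0, 0] 0 (g.replace X).encode)
      (N * edgeTime g N + (2 * N + 4)) := by
  have hX := (length_tuples_le_length_encode X).trans hN
  have h1 := stepsWithin_read φ g M₁ i (X.tuples.flatMap edgeWord) ![0, 0, 0, 0] 0 []
    (l := .header) (l' := .edge) (w := 2) rfl X.size 0
  rw [update_vec_two, update_vec_two, Nat.zero_add, ← encode_eq] at h1
  have h2 := h1.trans (stepsWithin_edges φ g M₁ i [] X.tuples ((Nat.le_add_right _ _).trans hX) hX)
  rw [List.append_nil, ← encode_replace] at h2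
  refine h2.mono ?_
  have h3 : X.tuples.length * edgeTime g N ≤ N * edgeTime g N := Nat.mul_le_mul_right _ (by omega)
  omega

end GadgetRun

end Turing.TM2

/-! ### The composed machine runs in polynomial time -/

namespace Turing

variable {L : FirstOrder.Language.{0, 0}} (g : Gadget L)

/-- The machine that applies gadget replacement to the output of a given machine, which writes down
graphs. -/
def gadgetFinTM2 (tm : FinTM2) (φ : tm.Γ tm.k₁ ≃ Letter FirstOrder.Language.graph) : FinTM2 :=
  letI := tm.kFin
  letI := tm.ΛFin
  letI := tm.σFin
  { K := tm.K ⊕ GadgetStack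
    k₀ := .inl tm.k₀
    k₁ := .inr .out
    Γ := Sum.elim tm.Γ (GadgetStack.alphabet L)
    Λ := tm.Λ ⊕ GadgetLabel g.items.length
    main := .inl tm.main
    σ := tm.σ × Option Token
    initialState := (tm.initialState, none)
    Γk₀Fin := tm.Γk₀Fin
    m := TM2.gadgetMachine φ g tm.m }

variable (tm : FinTM2) (φ : tm.Γ tm.k₁ ≃ Letter FirstOrder.Language.graph)

theorem initList_stk (s : List (tm.Γ tm.k₀)) :
    (initList tm s).stk = Function.update (fun _ => []) tm.k₀ s := by
  funext k
  by_cases h : k = tm.k₀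
  · subst h
    rw [Function.update_self]
    exact dif_pos rfl
  · rw [Function.update_of_ne h]
    exact dif_neg h

theorem haltList_stk (s : List (tm.Γ tm.k₁)) :
    (haltList tm s).stk = Function.update (fun _ => []) tm.k₁ s := by
  funext k
  by_cases h : k = tm.k₁
  · subst h
    rw [Function.update_self]
    exact dif_pos rfl
  · rw [Function.update_of_ne h]
    exact dif_neg h

theorem gadgetStacks_nil (L : FirstOrder.Language.{0, 0}) :
    TM2.gadgetStacks L ![0, 0, 0, 0] 0 [] = fun _ => [] := by
  funext k
  rcases k with w | _ | _
  · fin_cases w <;> rfl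
  · rfl
  · rfl

theorem joinStacks_nil {K₁ K₂ : Type} {Γ₁ : K₁ → Type} {Γ₂ : K₂ → Type} :
    joinStacks (Γ₁ := Γ₁) (Γ₂ := Γ₂) (fun _ => []) (fun _ => []) = fun _ => [] := by
  funext k
  rcases k with k | k <;> rfl

theorem initList_gadgetFinTM2 (s : List (tm.Γ tm.k₀)) :
    initList (gadgetFinTM2 g tm φ) s =
      TM2.Cfg.extend (GadgetLabel.header (n := g.items.length)) (none : Option Token)
        (TM2.gadgetStacks L ![0, 0, 0, 0] 0 []) (initList tm s) := by
  have h : (initList (gadgetFinTM2 g tm φ) s).stk =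
      joinStacks (initList tm s).stk (TM2.gadgetStacks L ![0, 0, 0, 0] 0 []) := by
    rw [initList_stk tm, gadgetStacks_nil]
    refine (initList_stk (gadgetFinTM2 g tm φ) s).trans ?_
    refine Eq.trans ?_ (update_joinStacks_inl (fun _ => []) (fun _ => []) tm.k₀ s)
    rw [joinStacks_nil]
    rfl
  exact congrArg (TM2.Cfg.mk (some (Sum.inl tm.main)) (tm.initialState, none)) h

/-- The handover: the first machine halts with its output as its only nonempty stack, first letter
on top, which is how the gadget program expects its input. -/
theorem extend_haltList (inp : List (Letter FirstOrder.Language.graph)) :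
    TM2.Cfg.extend (GadgetLabel.header (n := g.items.length)) (none : Option Token)
      (TM2.gadgetStacks L ![0, 0, 0, 0] 0 []) (haltList tm (inp.map φ.symm)) =
      TM2.gadgetCfg φ g tm.initialState (some .header) inp ![0, 0, 0, 0] 0 [] := by
  refine congrArg (TM2.Cfg.mk (some (Sum.inr GadgetLabel.header)) (tm.initialState, none)) ?_
  rw [haltList_stk]
  rfl

/-- A proper halting configuration has the initial internal state and no contents besides the
output. This is why the program empties its counters and forgets the last symbol read. -/
theorem haltList_gadgetFinTM2 (o : List (Letter L)) :
    haltList (gadgetFinTM2 g tm φ) o =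
      TM2.gadgetCfg φ g tm.initialState none [] ![0, 0, 0, 0] 0 o := by
  refine congrArg (TM2.Cfg.mk none (tm.initialState, none)) ?_
  refine (haltList_stk (gadgetFinTM2 g tm φ) o).trans ?_
  have h1 := update_joinStacks_inr (Γ₁ := tm.Γ) (fun _ => [])
    (TM2.gadgetStacks L ![0, 0, 0, 0] 0 []) .out o
  rw [TM2.update_gadgetStacks_out, gadgetStacks_nil, joinStacks_nil] at h1
  refine Eq.trans ?_ (h1.trans ?_)
  · rfl
  · refine congrArg (fun S => joinStacks S _) ?_
    exact (Function.update_eq_self tm.k₁ (fun _ => [])).symm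

/-- Gadget replacement preserves computability in polynomial time. -/
theorem nonempty_computableInPolyTime_replace {α αΓ : Type} {ea : α → List αΓ}
    {f : α → FinInstance FirstOrder.Language.graph}
    (h : TM2ComputableInPolyTime ea FinInstance.encode f) :
    Nonempty (TM2ComputableInPolyTime ea FinInstance.encode fun a => g.replace (f a)) := by
  classical
  let := h.tm.ΛFin
  let D : ℕ := ∑ l, TM2.Stmt.pushCount (h.tm.m l)
  -- A bound on the length of the intermediate graph: X allows for the input and output stacks of
  -- the first machine being the same, and the product bounds what it can push.
  let q : Polynomial ℕ := .X + h.time * .C D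
  refine ⟨{
    tm := gadgetFinTM2 g h.tm h.outputAlphabet
    inputAlphabet := h.inputAlphabet
    outputAlphabet := .refl _
    time := h.time + (q * (.C g.items.length * (2 * q + 3) + 4 * q + 6) + (2 * q + 4))
    outputsFun := fun a => Classical.choice ?_ }⟩
  obtain ⟨⟨k, hk⟩, hkt⟩ := h.outputsFun a
  have h1 : StepsWithin (TM2.step h.tm.m) (initList h.tm ((ea a).map h.inputAlphabet.invFun))
      (haltList h.tm ((f a).encode.map h.outputAlphabet.symm))
      (h.time.eval (ea a).length) := ⟨k, hkt, hk⟩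
  have hN : (f a).encode.length ≤ q.eval (ea a).length := by
    have h2 := TM2.length_stk_le_of_stepsWithin h.tm.m h1 h.tm.k₁
    rw [haltList_stk, Function.update_self, List.length_map] at h2
    refine h2.trans ?_
    have h3 : ((initList h.tm ((ea a).map h.inputAlphabet.invFun)).stk h.tm.k₁).length ≤
        (ea a).length := by
      rw [initList_stk]
      by_cases hk : h.tm.k₁ = h.tm.k₀
      · rw [hk, Function.update_self, List.length_map]
      · rw [Function.update_of_ne hk]
        exact Nat.zero_le _
    have hq : q.eval (ea a).length = (ea a).length + h.time.eval (ea a).length * D := by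
      rw [Polynomial.eval_add, Polynomial.eval_mul, Polynomial.eval_X, Polynomial.eval_C]
    rw [hq]
    exact Nat.add_le_add_right h3 _
  have h2 := TM2.stepsWithin_extend h.tm.m (TM2.gadgetProgram h.outputAlphabet g) .header
    (none : Option Token) (TM2.gadgetStacks L ![0, 0, 0, 0] 0 []) h1
  rw [extend_haltList, ← initList_gadgetFinTM2 g h.tm h.outputAlphabet] at h2
  have h3 := h2.trans
    (TM2.stepsWithin_gadgetProgram h.outputAlphabet g h.tm.m h.tm.initialState (f a) hN)
  rw [← haltList_gadgetFinTM2] at h3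
  obtain ⟨k', hk't, hk'⟩ := h3
  refine ⟨⟨⟨k', ?_⟩, hk't.trans ?_⟩⟩
  · refine hk'.trans ?_
    have h4 : (g.replace (f a)).encode.map (Equiv.refl (Letter L)).invFun =
        (g.replace (f a)).encode := List.map_id _
    exact congrArg (fun l => some (haltList (gadgetFinTM2 g h.tm h.outputAlphabet) l)) h4.symm
  · simp [TM2.edgeTime]

end Turing

theorem mainTheorem5
    (hK : ∀ r : ℕ, 3 ≤ r →
      NPHard FinInstance.encode (PCSP FirstOrder.Language.graph (Clique 3) (Clique r)))
    (L : FirstOrder.Language.{0, 0}) [L.IsRelational] [Finite (Σ n, L.Relations n)]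
    (C : Type*) [Countable C] [L.Structure C]
    (G : Subgroup (Equiv.Perm C)) (hG : G ≤ autGroup L C) (hGo : IsOligomorphic G)
    (hS : ¬ SatisfiesSiggersModulo L C (unaryClosure G)) :
    NPHard FinInstance.encode (CSP L C) := by
  obtain ⟨g, r, hr, hg⟩ := exists_gadget_of_not_satisfiesSiggersModulo L C G hG hGo hS
  intro S hNP
  obtain ⟨f, ⟨hf⟩, hyes, hno⟩ := hK r hr S hNP
  exact ⟨fun w => g.replace (f w), Turing.nonempty_computableInPolyTime_replace g hf,
    fun w hw => (hg (f w)).1 (hyes w hw), fun w hw h => hno w hw ((hg (f w)).2 h)⟩
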